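/- Let $n\ge 1$ and $m\ge 0$ be integers and let $\nu\ge 0$ be a real number with $2\nu\in\mathbb Z_{\ge 0}$. Write $\langle z,w\rangle=\sum_{i=1}^n z_i\overline{w_i}$ and $|z|^2=\langle z,z\rangle$ for $z,w\in\mathbb C^n$. For integers $p,q\ge 0$ let $\mathfrak H_{p,q}(\mathbb C^n)$ be the space of polynomials $u(z,\bar z)$ that are homogeneous of degree $p$ in $z$ and of degree $q$ in $\bar z$ and satisfy $\sum_{j=1}^n\frac{\partial^2u}{\partial z_j\partial\bar z_j}=0$. Let $d(n,p,q)$ be its dimension, and let $h^1_{p,q},\dots,h^{d(n,p,q)}_{p,q}$ be any basis of $\mathfrak H_{p,q}(\mathbb C^n)$ whose restrictions to the unit sphere of $\mathbb C^n$ are orthonormal in $L^2$ with respect to the surface measure (of total mass $2\pi^n/\Gamma(n)$). For $0\le p\le m$, $0\le q\le m+2\nu$ and $1\le j\le d(n,p,q)$ put $$\Phi^{p,q,m}_j(z)=\gamma^{n,\nu,m}_{p,q}\,(1+|z|^2)^{-m-\nu}\;{}_2F_1\big(p-m,\;q-m-2\nu;\;n+p+q;\;-|z|^2\big)\;h^j_{p,q}(z,\bar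 z),$$ where $$\gamma^{n,\nu,m}_{p,q}=\sqrt{\frac{2(2m+2\nu+n)\,\Gamma(m+q+n)\,\Gamma(m+2\nu+p+n)}{\Gamma(n+p+q)^2\,\Gamma(m-p+1)\,\Gamma(m+2\nu-q+1)}}.$$ Let $P_m^{(a,b)}(x)=2^{-m}\sum_{j=0}^m\binom{m+a}{j}\binom{m+b}{m-j}(x+1)^j(x-1)^{m-j}$ be the Jacobi polynomial, and let $d_{FS}(z,w)\in[0,\pi/2]$ be the Fubini–Study distance, given by $\cos^2d_{FS}(z,w)=\frac{|1+\langle z,w\rangle|^2}{(1+|z|^2)(1+|w|^2)}$. Then for all $z,w\in\mathbb C^n$ $$\sum_{p=0}^{m}\;\sum_{q=0}^{m+2\nu}\;\sum_{j=1}^{d(n,p,q)}\Phi^{p,q,m}_j(z)\,\overline{\Phi^{p,q,m}_j(w)}=\frac{(2m+2\nu+n)\,\Gamma(m+2\nu+n)}{\pi^n\,\Gamma(m+2\nu+1)}\;\frac{(1+\langle w,z\rangle)^{2\nu}}{\big((1+|z|^2)(1+|w|^2)\big)^{\nu}}\;P_m^{(n-1,2\nu)}\big(\cos 2d_{FS}(z,w)\big),$$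 and $$\cos 2d_{FS}(z,w)=\frac{2|1+\langle z,w\rangle|^2}{(1+|z|^2)(1+|w|^2)}-1.$$ -/

import Mathlib

open scoped BigOperators ComplexConjugate

noncomputable section

/-- The Hermitian product `⟨z, w⟩ = ∑ i, z i * conj (w i)` on `ℂⁿ`, linear in the first variable. -/
def hermProd {n : ℕ} (z w : EuclideanSpace ℂ (Fin n)) : ℂ :=
  ∑ i, z i * conj (w i)

/-- The bidegree of the variables: polynomials in `z` and `z̄` are elements of
`MvPolynomial (Fin n ⊕ Fin n) ℂ`, where `Sum.inl i` stands for `z i` and `Sum.inr i` for the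
conjugate of `z i`. -/
def bidegreeWeight (n : ℕ) : Fin n ⊕ Fin n → ℕ × ℕ :=
  Sum.elim (fun _ => (1, 0)) (fun _ => (0, 1))

/-- The value `u(z, z̄)` of a polynomial in `z` and `z̄` at the point `z`. -/
def evalConj {n : ℕ} (u : MvPolynomial (Fin n ⊕ Fin n) ℂ) (z : EuclideanSpace ℂ (Fin n)) : ℂ :=
  MvPolynomial.eval (Sum.elim (fun i => z i) (fun i => conj (z i))) u

/-- The complex Laplacian `∑ j, ∂² / ∂z_j ∂z̄_j` on polynomials in `z` and `z̄`. -/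
def complexLaplacian (n : ℕ) :
    MvPolynomial (Fin n ⊕ Fin n) ℂ →ₗ[ℂ] MvPolynomial (Fin n ⊕ Fin n) ℂ :=
  ∑ j : Fin n, (MvPolynomial.pderiv (R := ℂ) (Sum.inl j : Fin n ⊕ Fin n)).toLinearMap ∘ₗ
    (MvPolynomial.pderiv (R := ℂ) (Sum.inr j : Fin n ⊕ Fin n)).toLinearMap

/-- The space of harmonic polynomials on `ℂⁿ`, homogeneous of degree `p` in `z` and of degree `q`
in `z̄`. Restriction to the unit sphere identifies it with the space of complex spherical
harmonics of bidegree `(p, q)`. -/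
def bihomHarmonic (n p q : ℕ) : Submodule ℂ (MvPolynomial (Fin n ⊕ Fin n) ℂ) :=
  MvPolynomial.weightedHomogeneousSubmodule ℂ (bidegreeWeight n) (p, q) ⊓
    LinearMap.ker (complexLaplacian n)

/-- The dimension `d(n, p, q)` of the space of complex spherical harmonics. -/
def harmonicDim (n p q : ℕ) : ℕ :=
  Module.finrank ℂ (bihomHarmonic n p q)

/-- The inner product in `L²` of the unit sphere of `ℂⁿ` of the restrictions of two polynomials in
`z` and `z̄`, with respect to the surface measure, of total mass `2 π ^ n / Γ(n)`. -/
def sphereInner {n : ℕ} (u v : MvPolynomial (Fin n ⊕ Fin n) ℂ) : ℂ :=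
  ∫ x : Metric.sphere (0 : EuclideanSpace ℂ (Fin n)) 1,
    evalConj u (x : EuclideanSpace ℂ (Fin n)) * conj (evalConj v (x : EuclideanSpace ℂ (Fin n)))
    ∂((MeasureTheory.volume : MeasureTheory.Measure (EuclideanSpace ℂ (Fin n))).toSphere)

/-- A basis of the space of spherical harmonics of bidegree `(p, q)` is orthonormal in `L²` of the
unit sphere with its surface measure. -/
def IsSphereOrthonormal {n p q : ℕ}
    (h : Module.Basis (Fin (harmonicDim n p q)) ℂ (bihomHarmonic n p q)) : Prop :=
  ∀ i j, sphereInner (h i : MvPolynomial (Fin n ⊕ Fin n) ℂ)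
    (h j : MvPolynomial (Fin n ⊕ Fin n) ℂ) = if i = j then 1 else 0

/-- The binomial coefficient `a (a - 1) ⋯ (a - j + 1) / j!` for a real number `a`. -/
def realBinom (a : ℝ) (j : ℕ) : ℝ :=
  (∏ i ∈ Finset.range j, (a - i)) / (j.factorial : ℝ)

/-- The value at `x` of the Jacobi polynomial of degree `k` with parameters `a` and `b`. -/
def jacobiP (k : ℕ) (a b x : ℝ) : ℝ :=
  ((2 : ℝ) ^ k)⁻¹ * ∑ j ∈ Finset.range (k + 1),
    realBinom (k + a) j * realBinom (k + b) (k - j) * (x + 1) ^ j * (x - 1) ^ (k - j)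

/-- The normalizing constant `γ_{p,q}^{n,ν,m}`. -/
def normConst (n : ℕ) (ν : ℝ) (m p q : ℕ) : ℝ :=
  Real.sqrt
    ((2 * (2 * m + 2 * ν + n) * Real.Gamma (m + q + n) * Real.Gamma (m + 2 * ν + p + n)) /
      (Real.Gamma (n + p + q) ^ 2 * Real.Gamma ((m : ℝ) - p + 1) *
        Real.Gamma ((m : ℝ) + 2 * ν - q + 1)))

/-- The function
`γ (1 + ⟨z,z⟩) ^ (-m - ν) ₂F₁(p - m, q - m - 2ν; n + p + q; -⟨z,z⟩) h(z, z̄)`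
attached to a polynomial `h` in `z` and `z̄`. -/
def eigenPhi {n : ℕ} (ν : ℝ) (m p q : ℕ) (h : MvPolynomial (Fin n ⊕ Fin n) ℂ)
    (z : EuclideanSpace ℂ (Fin n)) : ℂ :=
  ((normConst n ν m p q * (1 + ‖z‖ ^ 2) ^ (-(m : ℝ) - ν) *
      ordinaryHypergeometric ((p : ℝ) - m) ((q : ℝ) - m - 2 * ν) ((n : ℝ) + p + q) (-‖z‖ ^ 2) :
        ℝ) : ℂ) * evalConj h z

/-- The Fubini–Study distance, the number in `[0, π / 2]` such that
`cos² d(z, w) = |1 + ⟨z,w⟩|² / ((1 + |z|²) (1 + |w|²))`. -/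
def fubiniStudyDist {n : ℕ} (z w : EuclideanSpace ℂ (Fin n)) : ℝ :=
  Real.arccos (‖1 + hermProd z w‖ / Real.sqrt ((1 + ‖z‖ ^ 2) * (1 + ‖w‖ ^ 2)))

end

/-! Put k = 2ν, s = ⟨z,w⟩, t = ⟨w,z⟩, a = |z|², b = |w|². Since cos² d = (1+s)(1+t)/((1+a)(1+b)),
the right side is, up to constants and powers of (1+a)(1+b), the polynomial K = ∑ e_l (1+s)^l
(1+t)^(l+k) ((1+a)(1+b))^(m-l), with e_l the coefficients of the Jacobi polynomial in y = cos² d.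
The theorem is the decomposition of K into bidegrees.

As a function of z, K solves ΔK + (E - m)(Ē - m - k)K = 0, where Δ is the complex Laplacian and E, Ē
are the Euler operators in z and z̄ (`kernelCoeff_rec`). For h harmonic of bidegree (p,q), the
product R(|z|²)h solves the same equation when R(x) = ₂F₁(p-m, q-m-k; n+p+q; -x)
(`radialCoeff_succ`). Written in s, t, a, the equation determines the coefficient of a^(i+1) from
those of a^i, so a solution is known from its part free of a. Comparing these parts gives K = ∑
c_{pq} R_{pq}(a) R_{pq}(b) Z_{pq}, with Z_{pq} the zonal harmonic (`kernelCoeff_eq_sum_zonalWeight`,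
`sum_kernelBase_mul_zonalPoly`). All this is done on formal coefficients, so relations such as st =
ab for n = 1 play no role.

The sum ∑ h_j(z) conj(h_j(w)) is a multiple of Z_{pq}, because Z_{pq} reproduces point values on the
sphere (`sphereInner_zonalMv`). Sphere integrals are reduced to Gaussian moments, where integration
by parts is algebra. The closed form of c_{pq} (`kernelBase_eq`) then matches γ²
(`normConst_sq_mul`). -/

noncomputable section

/-! ### Jacobi coefficients and the differential equation of the kernel -/

/-- The coefficients of the Jacobi polynomial `P_m^{(n-1,k)}(2 y - 1)` in powers of `y`. -/
def jacobiCoeff (n m k : ℕ) : ℕ → ℝ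
  | 0 => (-1) ^ m * ((m + k).choose m : ℝ)
  | l + 1 => -(((m : ℝ) - l) * (l + m + n + k) / ((l + 1) * (l + 1 + k))) * jacobiCoeff n m k l

theorem jacobiCoeff_succ (n m k l : ℕ) :
    jacobiCoeff n m k (l + 1) * ((l + 1) * (l + 1 + k)) =
      -((m : ℝ) - l) * (l + m + n + k) * jacobiCoeff n m k l := by
  have h1 : ((l : ℝ) + 1) ≠ 0 := by positivity
  have h2 : ((l : ℝ) + 1 + k) ≠ 0 := by positivity
  rw [jacobiCoeff]
  field_simp

theorem cast_choose_succ_right (l a : ℕ) :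
    ((a : ℝ) + 1) * (l.choose (a + 1) : ℝ) = ((l : ℝ) - a) * (l.choose a : ℝ) := by
  rcases le_or_gt a l with h | h
  · have := Nat.choose_succ_right_eq l a
    have h' : ((l - a : ℕ) : ℝ) = (l : ℝ) - a := by push_cast [h]; ring
    rw [← h']
    exact_mod_cast (by linarith : (a + 1) * l.choose (a + 1) = (l - a) * l.choose a)
  · simp [Nat.choose_eq_zero_of_lt h, Nat.choose_eq_zero_of_lt (h.trans (Nat.lt_succ_self a))]

theorem cast_choose_succ_left (l a : ℕ) :
    ((l : ℝ) + 1 - a) * ((l + 1).choose a : ℝ) = ((l : ℝ) + 1) * (l.choose a : ℝ) := by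
  have h1 := cast_choose_succ_right (l + 1) a
  have h2 : ((l : ℝ) + 1) * (l.choose a : ℝ) = ((l + 1).choose (a + 1) : ℝ) * (a + 1) := by
    exact_mod_cast Nat.add_one_mul_choose_eq l a
  push_cast at h1
  linarith

/-- The coefficient of `s ^ α * t ^ β * a ^ i` in
`∑ l, e l * (1 + s) ^ l * (1 + t) ^ (l + k) * ((1 + a) * (1 + b)) ^ (m - l)`,
where `e` are the coefficients of the Jacobi polynomial. -/
def kernelCoeff (n m k : ℕ) (b : ℝ) (α β i : ℕ) : ℝ :=
  ∑ l ∈ Finset.range (m + 1), jacobiCoeff n m k l * (l.choose α : ℝ) * ((l + k).choose β : ℝ) *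
    ((m - l).choose i : ℝ) * (1 + b) ^ (m - l)

/-- This is ΔK + (E - m)(Ē - m - k)K = 0 read off at s^α t^β a^i: on functions of s, t, a one has Δ
= b ∂_s∂_t + ∂_a(θ_s + θ_t + θ_a + n - 1), E = θ_s + θ_a and Ē = θ_t + θ_a, where θ_x = x∂_x. The
recurrence of the e_l makes the sum over l telescope. -/
theorem kernelCoeff_rec (n m k : ℕ) (b : ℝ) (α β i : ℕ) :
    b * (α + 1) * (β + 1) * kernelCoeff n m k b (α + 1) (β + 1) i +
      (i + 1) * (α + β + i + n) * kernelCoeff n m k b α β (i + 1) +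
      ((α : ℝ) + i - m) * ((β : ℝ) + i - m - k) * kernelCoeff n m k b α β i = 0 := by
  let P : ℕ → ℝ := fun l => jacobiCoeff n m k l * (((l : ℝ) - α) * l.choose α) *
    (((l : ℝ) + k - β) * (l + k).choose β) * ((m - l).choose i : ℝ) * (1 + b) ^ (m + 1 - l)
  have key : ∀ l ∈ Finset.range (m + 1),
      b * (α + 1) * (β + 1) * (jacobiCoeff n m k l * (l.choose (α + 1) : ℝ) *
        ((l + k).choose (β + 1) : ℝ) * ((m - l).choose i : ℝ) * (1 + b) ^ (m - l)) +
      (i + 1) * (α + β + i + n) * (jacobiCoeff n m k l * (l.choose α : ℝ) *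
        ((l + k).choose β : ℝ) * ((m - l).choose (i + 1) : ℝ) * (1 + b) ^ (m - l)) +
      ((α : ℝ) + i - m) * ((β : ℝ) + i - m - k) * (jacobiCoeff n m k l * (l.choose α : ℝ) *
        ((l + k).choose β : ℝ) * ((m - l).choose i : ℝ) * (1 + b) ^ (m - l)) =
      P l - P (l + 1) := by
    intro l hl
    have hl : l ≤ m := by simpa [Nat.lt_succ_iff] using hl
    obtain ⟨M, rfl⟩ := Nat.exists_eq_add_of_le hl
    have c1 := cast_choose_succ_right l α
    have c2 := cast_choose_succ_right (l + k) β
    have c3 := cast_choose_succ_right M i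
    have c4 := cast_choose_succ_left l α
    have c5 := cast_choose_succ_left (l + k) β
    have e1 := jacobiCoeff_succ n (l + M) k l
    have hM : l + M - l = M := by omega
    have hM1 : l + M + 1 - l = M + 1 := by omega
    have hM2 : l + M + 1 - (l + 1) = M := by omega
    have hlk : l + 1 + k = l + k + 1 := by omega
    simp only [P, hM, hM1, hM2, hlk]
    push_cast at *
    have c5' : ((l : ℝ) + 1 + k - β) * ((l + k + 1).choose β : ℝ) =
        ((l : ℝ) + k + 1) * ((l + k).choose β : ℝ) := by linear_combination c5
    rw [c4, c5']
    -- The last index l = m is separate: there m - (l+1) is truncated to 0, and the next Jacobi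
    -- coefficient vanishes.
    rcases M with _ | M
    · have e1' : jacobiCoeff n l k (l + 1) * ((l + 1) * (l + 1 + k)) = 0 := by
        simpa using e1
      rcases i with _ | i
      · simp only [Nat.sub_self, CharP.cast_eq_zero, zero_add, Nat.choose_zero_right,
          Nat.choose_zero_succ, Nat.cast_one, add_zero, pow_zero, pow_one, mul_one,
          mul_zero, show l - (l + 1) = 0 by omega] at *
        linear_combination b * jacobiCoeff n l k l * (β + 1) * ((l + k).choose (β + 1)) * c1 +
          b * jacobiCoeff n l k l * (l - α) * (l.choose α) * c2 +
          (l.choose α) * ((l + k).choose β) * e1'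
      · simp
    · have hM3 : l + (M + 1) - (l + 1) = M := by omega
      have c6 := cast_choose_succ_left M i
      rw [hM3]
      push_cast at *
      set C1 := (l.choose α : ℝ)
      set C2 := ((l + k).choose β : ℝ)
      set C3 := ((M + 1).choose i : ℝ)
      set E := jacobiCoeff n (l + (M + 1)) k l
      set B := (1 + b) ^ (M + 1)
      rw [pow_succ (1 + b) (M + 1)]
      change _ = _ * (B * (1 + b)) - _ * B
      linear_combination b * E * C3 * B * (β + 1) * ((l + k).choose (β + 1)) * c1 +
          b * E * C3 * B * (l - α) * C1 * c2 + (α + β + i + n) * E * C1 * C2 * B * c3 +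
          C1 * C2 * B * (M.choose i) * e1 + (n + l + k + l + (M + 1)) * E * C1 * C2 * B * c6
  unfold kernelCoeff
  rw [Finset.mul_sum, Finset.mul_sum, Finset.mul_sum, ← Finset.sum_add_distrib,
    ← Finset.sum_add_distrib, Finset.sum_congr rfl key, Finset.sum_range_sub']
  have h0 : P 0 = 0 := by
    rcases α with _ | α <;> simp [P]
  have h1 : P (m + 1) = 0 := by
    have h := jacobiCoeff_succ n m k m
    have : jacobiCoeff n m k (m + 1) = 0 := by
      have h2 : ((m : ℝ) + 1) * (m + 1 + k) ≠ 0 := by positivity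
      simpa [h2] using h
    simp [P, this]
  rw [h0, h1, sub_zero]

/-! ### The constants of the expansion -/

/-- The coefficient of `s ^ p * t ^ q` in `∑ l, e l * (1 + s) ^ l * (1 + t) ^ (l + k)`. -/
def kernelBase (n m k p q : ℕ) : ℝ :=
  ∑ l ∈ Finset.range (m + 1), jacobiCoeff n m k l * (l.choose p : ℝ) * ((l + k).choose q : ℝ)

theorem kernelCoeff_zero_zero (n m k p q : ℕ) :
    kernelCoeff n m k 0 p q 0 = kernelBase n m k p q := by
  simp [kernelCoeff, kernelBase]

/-- The generating function is (1+t)^k times a function of (1+s)(1+t), so (1+s)∂_s - (1+t)∂_t + k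
annihilates it. This holds summand by summand and uses nothing about the e_l. -/
theorem kernelBase_rec_sub (n m k p q : ℕ) :
    ((p : ℝ) - q + k) * kernelBase n m k p q + (p + 1) * kernelBase n m k (p + 1) q -
      (q + 1) * kernelBase n m k p (q + 1) = 0 := by
  unfold kernelBase
  rw [Finset.mul_sum, Finset.mul_sum, Finset.mul_sum, ← Finset.sum_add_distrib,
    ← Finset.sum_sub_distrib]
  refine Finset.sum_eq_zero fun l _ => ?_
  have c1 := cast_choose_succ_right l p
  have c2 := cast_choose_succ_right (l + k) q
  push_cast at c2
  linear_combination jacobiCoeff n m k l * ((l + k).choose q) * c1 -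
    jacobiCoeff n m k l * (l.choose p) * c2

/-- Here the Jacobi recurrence enters. Together with `kernelBase_rec_sub` it gives two linear
relations among three neighbouring constants, and eliminating one neighbour leaves first-order
recurrences in p and in q. -/
theorem kernelBase_rec_mul (n m k p q : ℕ) :
    ((p : ℝ) - m) * (q + m + n) * kernelBase n m k p q +
      ((p : ℝ) - m) * (q + 1) * kernelBase n m k p (q + 1) +
      (p + 1) * (q + m + n) * kernelBase n m k (p + 1) q = 0 := by
  let P : ℕ → ℝ := fun l => jacobiCoeff n m k l * (((l : ℝ) - p) * l.choose p) *
    (((l : ℝ) + k - q) * (l + k).choose q)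
  unfold kernelBase
  rw [Finset.mul_sum, Finset.mul_sum, Finset.mul_sum, ← Finset.sum_add_distrib,
    ← Finset.sum_add_distrib]
  have key : ∀ l ∈ Finset.range (m + 1),
      ((p : ℝ) - m) * (q + m + n) *
        (jacobiCoeff n m k l * (l.choose p : ℝ) * ((l + k).choose q : ℝ)) +
      ((p : ℝ) - m) * (q + 1) *
        (jacobiCoeff n m k l * (l.choose p : ℝ) * ((l + k).choose (q + 1) : ℝ)) +
      (p + 1) * (q + m + n) *
        (jacobiCoeff n m k l * (l.choose (p + 1) : ℝ) * ((l + k).choose q : ℝ)) =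
      P (l + 1) - P l := by
    intro l _
    have c1 := cast_choose_succ_right l p
    have c2 := cast_choose_succ_right (l + k) q
    have c4 := cast_choose_succ_left l p
    have c5 := cast_choose_succ_left (l + k) q
    have e1 := jacobiCoeff_succ n m k l
    have hlk : l + 1 + k = l + k + 1 := by omega
    simp only [P, hlk]
    push_cast at *
    have c5' : ((l : ℝ) + 1 + k - q) * ((l + k + 1).choose q : ℝ) =
        ((l : ℝ) + k + 1) * ((l + k).choose q : ℝ) := by linear_combination c5
    rw [c4, c5']
    set C1 := (l.choose p : ℝ)
    set C2 := ((l + k).choose q : ℝ)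
    set E := jacobiCoeff n m k l
    -- The underlying identity is (p-m)(q+m+n) + (p-m)(l+k-q) + (l-p)(q+m+n) = (l-m)(l+k+m+n) -
    -- (l-p)(l+k-q).
    linear_combination ((p : ℝ) - m) * E * C1 * c2 + (q + m + n) * E * C2 * c1 - C1 * C2 * e1
  rw [Finset.sum_congr rfl key, Finset.sum_range_sub]
  have h0 : P 0 = 0 := by
    rcases p with _ | p <;> simp [P]
  have h1 : P (m + 1) = 0 := by
    have h := jacobiCoeff_succ n m k m
    have : jacobiCoeff n m k (m + 1) = 0 := by
      have h2 : ((m : ℝ) + 1) * (m + 1 + k) ≠ 0 := by positivity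
      simpa [h2] using h
    simp [P, this]
  rw [h0, h1, sub_zero]

theorem kernelBase_succ_right (n m k p q : ℕ) :
    ((q : ℝ) + 1) * (p + q + n) * kernelBase n m k p (q + 1) =
      (q + m + n) * ((m : ℝ) + k - q) * kernelBase n m k p q := by
  linear_combination kernelBase_rec_mul n m k p q - (q + m + n) * kernelBase_rec_sub n m k p q

theorem kernelBase_succ_left (n m k p q : ℕ) :
    ((p : ℝ) + 1) * (p + q + n) * kernelBase n m k (p + 1) q =
      (m + k + p + n) * ((m : ℝ) - p) * kernelBase n m k p q := by
  linear_combination kernelBase_rec_mul n m k p q + (p - m) * kernelBase_rec_sub n m k p q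

/-! ### Explicit Jacobi coefficients and closed form of the constants -/

theorem jacobiCoeff_eq (n m k l : ℕ) (hl : l ≤ m) :
    jacobiCoeff (n + 1) m k l =
      (-1) ^ (m - l) * ((m + k).choose (m - l) : ℝ) * ((m + n + (k + l)).choose l : ℝ) := by
  induction l with
  | zero => simp [jacobiCoeff]
  | succ l ih =>
    have h := ih (by omega)
    obtain ⟨M, rfl⟩ := Nat.exists_eq_add_of_le hl
    have e := jacobiCoeff_succ (n + 1) (l + 1 + M) k l
    rw [h] at e
    have h1 : l + 1 + M - l = M + 1 := by omega
    have h2 : l + 1 + M - (l + 1) = M := by omega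
    have c1 := cast_choose_succ_right (l + 1 + M + k) M
    have c2 : ((l + 1 + M + n + (k + l) : ℕ) + 1 : ℝ) *
        ((l + 1 + M + n + (k + l)).choose l : ℝ) =
        ((l + 1 + M + n + (k + l) + 1).choose (l + 1) : ℝ) * (l + 1) := by
      exact_mod_cast Nat.add_one_mul_choose_eq (l + 1 + M + n + (k + l)) l
    have h3 : ((l : ℝ) + 1) * (l + 1 + k) ≠ 0 := by positivity
    rw [h1, pow_succ] at e
    rw [h2, show l + 1 + M + n + (k + (l + 1)) = l + 1 + M + n + (k + l) + 1 by ring]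
    apply mul_right_cancel₀ h3
    rw [e]
    push_cast at *
    set C1 := ((l + 1 + M + k).choose (M + 1) : ℝ)
    set C2 := ((l + 1 + M + k).choose M : ℝ)
    set C3 := ((l + 1 + M + n + (k + l)).choose l : ℝ)
    linear_combination (-1 : ℝ) ^ M * (l + (l + 1 + M) + (n + 1) + k) * C3 * c1 +
      (-1 : ℝ) ^ M * C2 * (l + 1 + k) * c2

/-- Expand (y-1)^(m-j) and collect y^l. After trinomial revision of the binomials, the sum over j is
Vandermonde's convolution. -/
theorem sum_choose_mul_pow_eq_sum_jacobiCoeff (n m k : ℕ) (y : ℝ) :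
    ∑ j ∈ Finset.range (m + 1), ((m + n).choose j : ℝ) * ((m + k).choose (m - j) : ℝ) *
      y ^ j * (y - 1) ^ (m - j) =
    ∑ l ∈ Finset.range (m + 1), jacobiCoeff (n + 1) m k l * y ^ l := by
  let f : ℕ → ℕ → ℝ := fun j i => ((m + n).choose j : ℝ) * ((m + k).choose (m - j) : ℝ) *
    ((m - j).choose i : ℝ) * y ^ (i + j) * (-1) ^ (m - j - i)
  have h1 : ∀ j ∈ Finset.range (m + 1), ((m + n).choose j : ℝ) * ((m + k).choose (m - j) : ℝ) *
      y ^ j * (y - 1) ^ (m - j) = ∑ i ∈ Finset.range (m + 1 - j), f j i := by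
    intro j hj
    have hj : j ≤ m := by simpa [Nat.lt_succ_iff] using hj
    rw [sub_eq_add_neg, add_pow, Finset.mul_sum, show m - j + 1 = m + 1 - j by omega]
    refine Finset.sum_congr rfl fun i _ => ?_
    simp only [f, pow_add]
    ring
  rw [Finset.sum_congr rfl h1, ← Finset.sum_range_diag_flip (m + 1) f]
  refine Finset.sum_congr rfl fun l hl => ?_
  have hl : l ≤ m := by simpa [Nat.lt_succ_iff] using hl
  rw [jacobiCoeff_eq n m k l hl, Nat.add_choose_eq (m + n) (k + l) l,
    Finset.Nat.sum_antidiagonal_eq_sum_range_succ_mk, Nat.cast_sum, Finset.mul_sum, Finset.sum_mul]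
  refine Finset.sum_congr rfl fun j hj => ?_
  have hj : j ≤ l := by simpa [Nat.lt_succ_iff] using hj
  have h2 : (m + k).choose (m - j) * (m - j).choose (l - j) =
      (m + k).choose (m - l) * (k + l).choose (l - j) := by
    rw [← Nat.choose_symm (show l - j ≤ m - j by omega), show m - j - (l - j) = m - l by omega,
      Nat.choose_mul (by omega), show m + k - (m - l) = k + l by omega,
      show m - j - (m - l) = l - j by omega]
  have h3 : ((m + k).choose (m - j) : ℝ) * ((m - j).choose (l - j) : ℝ) =
      ((m + k).choose (m - l) : ℝ) * ((k + l).choose (l - j) : ℝ) := by exact_mod_cast h2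
  simp only [f]
  rw [show l - j + j = l by omega, show m - j - (l - j) = m - l by omega]
  push_cast
  linear_combination ((m + n).choose j : ℝ) * y ^ l * (-1) ^ (m - l) * h3

theorem realBinom_natCast (a j : ℕ) : realBinom (a : ℝ) j = (a.choose j : ℝ) := by
  rw [realBinom, div_eq_iff (by positivity)]
  induction j with
  | zero => simp
  | succ j ih =>
    rw [Finset.prod_range_succ, ih, Nat.factorial_succ]
    push_cast
    linear_combination (-(j.factorial : ℝ)) * cast_choose_succ_right a j

theorem jacobiP_eq_sum (n m k : ℕ) (y : ℝ) :
    jacobiP m n k (2 * y - 1) =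
      ∑ l ∈ Finset.range (m + 1), jacobiCoeff (n + 1) m k l * y ^ l := by
  rw [← sum_choose_mul_pow_eq_sum_jacobiCoeff, jacobiP, Finset.mul_sum]
  refine Finset.sum_congr rfl fun j hj => ?_
  have hj : j ≤ m := by simpa [Nat.lt_succ_iff] using hj
  have h1 := realBinom_natCast (m + n) j
  have h2 := realBinom_natCast (m + k) (m - j)
  push_cast at h1 h2
  rw [h1, h2, show 2 * y - 1 + 1 = 2 * y by ring, show 2 * y - 1 - 1 = 2 * (y - 1) by ring,
    mul_pow, mul_pow]
  have h3 : (2 : ℝ) ^ m = 2 ^ j * 2 ^ (m - j) := by rw [← pow_add]; congr 1; omega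
  rw [h3]
  field_simp

/-- This constant is the Jacobi polynomial at y = 1, where only the summand j = m survives. -/
theorem kernelBase_zero_zero (n m k : ℕ) :
    kernelBase (n + 1) m k 0 0 = ((m + n).choose m : ℝ) := by
  have h := sum_choose_mul_pow_eq_sum_jacobiCoeff n m k 1
  rw [Finset.sum_range_succ, Finset.sum_eq_zero] at h
  · simpa [kernelBase] using h.symm
  · intro j hj
    have : m - j ≠ 0 := by have := Finset.mem_range.1 hj; omega
    simp [this]

/-- Iterating the first-order recurrences from (0,0), first along p with q = 0 and then along q,
gives a quotient of factorials; it is stated with denominators cleared. -/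
theorem kernelBase_eq (n m k p q : ℕ) (hp : p ≤ m) (hq : q ≤ m + k) :
    kernelBase (n + 1) m k p q * ((n + p + q).factorial * (m - p).factorial *
      (m + k - q).factorial * p.factorial * q.factorial * (m + k + n).factorial : ℝ) =
    (m + q + n).factorial * (m + k + p + n).factorial * (m + k).factorial := by
  induction q with
  | zero =>
    induction p with
    | zero =>
      rw [kernelBase_zero_zero]
      have h : ((m + n).choose m : ℝ) * m.factorial * n.factorial = (m + n).factorial := by
        rw [Nat.choose_symm_add]
        exact_mod_cast Nat.add_choose_mul_factorial_mul_factorial m n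
      simp only [Nat.add_zero, Nat.sub_zero, Nat.factorial_zero, Nat.cast_one]
      linear_combination ((m + k).factorial : ℝ) * (m + k + n).factorial * h
    | succ p ih =>
      have h := ih (by omega)
      have r := kernelBase_succ_left (n + 1) m k p 0
      obtain ⟨M, rfl⟩ := Nat.exists_eq_add_of_le hp
      rw [show p + 1 + M - p = M + 1 by omega] at h
      rw [show p + 1 + M - (p + 1) = M by omega,
        show n + (p + 1) + 0 = (n + p + 0) + 1 by ring,
        show p + 1 + M + k + (p + 1) + n = (p + 1 + M + k + p + n) + 1 by ring]
      simp only [Nat.factorial_succ] at h ⊢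
      push_cast at *
      set K0 := kernelBase (n + 1) (p + 1 + M) k p 0
      set K1 := kernelBase (n + 1) (p + 1 + M) k (p + 1) 0
      generalize ((n + p + 0).factorial : ℝ) = F1 at *
      generalize ((p + 1 + M + k - 0).factorial : ℝ) = F2 at *
      generalize ((p + 1 + M + k + n).factorial : ℝ) = F3 at *
      generalize ((p + 1 + M + k + p + n).factorial : ℝ) = F4 at *
      linear_combination F1 * F2 * F3 * M.factorial * p.factorial * Nat.factorial 0 * r +
        (p + 1 + M + k + p + n + 1) * h
  | succ q ih =>
    have h := ih (by omega)
    have r := kernelBase_succ_right (n + 1) m k p q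
    obtain ⟨M, hM⟩ := Nat.exists_eq_add_of_le hq
    have hM' : (m : ℝ) + k = q + 1 + M := by exact_mod_cast hM
    rw [show m + k - q = M + 1 by omega] at h
    rw [show m + k - (q + 1) = M by omega, show n + p + (q + 1) = (n + p + q) + 1 by ring,
      show m + (q + 1) + n = (m + q + n) + 1 by ring]
    rw [hM'] at r
    simp only [Nat.factorial_succ] at h ⊢
    push_cast at *
    set K0 := kernelBase (n + 1) m k p q
    set K1 := kernelBase (n + 1) m k p (q + 1)
    generalize ((n + p + q).factorial : ℝ) = F1 at *
    generalize ((m - p).factorial : ℝ) = F2 at *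
    generalize ((m + k + n).factorial : ℝ) = F3 at *
    generalize ((m + q + n).factorial : ℝ) = F4 at *
    linear_combination F1 * F2 * F3 * M.factorial * p.factorial * q.factorial * r +
      (m + q + n + 1) * h

theorem kernelBase_eq_zero_left (n m k p q : ℕ) (hp : m < p) : kernelBase n m k p q = 0 :=
  Finset.sum_eq_zero fun l hl => by
    have := Finset.mem_range.1 hl
    simp [Nat.choose_eq_zero_of_lt (show l < p by omega)]

theorem kernelBase_eq_zero_right (n m k p q : ℕ) (hq : m + k < q) : kernelBase n m k p q = 0 :=
  Finset.sum_eq_zero fun l hl => by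
    have := Finset.mem_range.1 hl
    simp [Nat.choose_eq_zero_of_lt (show l + k < q by omega)]

/-! ### Hypergeometric radial factors -/

/-- The coefficients of `x ↦ ₂F₁(p - m, q - m - k; n + p + q; -x)`. -/
def radialCoeff (n m k p q I : ℕ) : ℝ :=
  (-1) ^ I * ordinaryHypergeometricCoefficient ((p : ℝ) - m) ((q : ℝ) - m - k) ((n : ℝ) + p + q) I

theorem radialCoeff_zero (n m k p q : ℕ) : radialCoeff n m k p q 0 = 1 := by
  simp [radialCoeff, ordinaryHypergeometricCoefficient]

/-- The equation of the kernel for a product R(|z|²)h with h harmonic of bidegree (p,q): Δ acts on R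
as x∂² + (n+p+q)∂, while E and Ē act as θ + p and θ + q. -/
theorem radialCoeff_succ (n m k p q I : ℕ) (hn : 1 ≤ n) :
    ((I : ℝ) + 1) * (n + p + q + I) * radialCoeff n m k p q (I + 1) =
      -((p : ℝ) - m + I) * ((q : ℝ) - m - k + I) * radialCoeff n m k p q I := by
  have hn' : (1 : ℝ) ≤ n := by exact_mod_cast hn
  have h0 : (0 : ℝ) < n + p + q + I := by positivity
  have h1 : (0 : ℝ) < (ascPochhammer ℝ I).eval ((n : ℝ) + p + q) :=
    ascPochhammer_pos _ _ (by positivity)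
  simp only [radialCoeff, ordinaryHypergeometricCoefficient, ascPochhammer_succ_eval,
    Nat.factorial_succ, pow_succ]
  push_cast
  field_simp

theorem radialCoeff_eq_zero (n m k p q I : ℕ) (hp : p ≤ m) (hI : m < p + I) :
    radialCoeff n m k p q I = 0 := by
  have h : (ascPochhammer ℝ I).eval ((p : ℝ) - m) = 0 := by
    rw [show (p : ℝ) - m = -((m - p : ℕ) : ℝ) by push_cast [hp]; ring,
      ascPochhammer_eval_neg_coe_nat_of_lt (by omega)]
  simp [radialCoeff, ordinaryHypergeometricCoefficient, h]

/-- The polynomial `∑ I, radialCoeff I * x ^ I`. -/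
def radialPoly (n m k p q : ℕ) (x : ℝ) : ℝ :=
  ∑ I ∈ Finset.range (m + 1), radialCoeff n m k p q I * x ^ I

theorem ordinaryHypergeometric_neg_eq_radialPoly (n m k p q : ℕ) (hp : p ≤ m) (x : ℝ) :
    ordinaryHypergeometric ((p : ℝ) - m) ((q : ℝ) - m - k) ((n : ℝ) + p + q) (-x) =
      radialPoly n m k p q x := by
  rw [ordinaryHypergeometric_eq_tsum]
  have h : ∀ I, ordinaryHypergeometricCoefficient ((p : ℝ) - m) ((q : ℝ) - m - k)
      ((n : ℝ) + p + q) I • (-x) ^ I = radialCoeff n m k p q I * x ^ I := by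
    intro I
    rw [radialCoeff, neg_pow, smul_eq_mul]
    ring
  simp only [h]
  refine tsum_eq_sum fun I hI => ?_
  rw [radialCoeff_eq_zero n m k p q I hp (by simp at hI; omega), zero_mul]

/-- At b = 0 the mixed term of `kernelCoeff_rec` disappears, and what remains is the recurrence of
the radial coefficients. -/
theorem kernelCoeff_zero_eq (n m k p q j : ℕ) (hn : 1 ≤ n) :
    kernelCoeff n m k 0 p q j = kernelBase n m k p q * radialCoeff n m k p q j := by
  induction j with
  | zero => rw [kernelCoeff_zero_zero, radialCoeff_zero, mul_one]
  | succ j ih =>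
    have hn' : (1 : ℝ) ≤ n := by exact_mod_cast hn
    have h0 : ((j : ℝ) + 1) * (n + p + q + j) ≠ 0 := by positivity
    have h1 := kernelCoeff_rec n m k 0 p q j
    have h2 := radialCoeff_succ n m k p q j hn
    apply mul_left_cancel₀ h0
    rw [ih] at h1
    linear_combination h1 - kernelBase n m k p q * h2

/-- The kernel is symmetric in a and b, so its part free of a, as a polynomial in b, has the
coefficients found at b = 0 as a polynomial in a. -/
theorem kernelCoeff_zero_right (n m k p q : ℕ) (b : ℝ) (hn : 1 ≤ n) :
    kernelCoeff n m k b p q 0 = kernelBase n m k p q * radialPoly n m k p q b := by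
  simp only [radialPoly, Finset.mul_sum, ← mul_assoc, ← kernelCoeff_zero_eq n m k p q _ hn]
  simp only [kernelCoeff, Finset.sum_mul]
  rw [Finset.sum_comm]
  refine Finset.sum_congr rfl fun l hl => ?_
  have h : (1 + b) ^ (m - l) = ∑ j ∈ Finset.range (m + 1), ((m - l).choose j : ℝ) * b ^ j := by
    rw [add_comm, add_pow]
    refine Finset.sum_subset_zero_on_sdiff (Finset.range_mono (by omega)) (fun j hj => ?_)
      (fun j _ => by rw [one_pow, mul_one, mul_comm])
    have := (Finset.mem_sdiff.1 hj).2
    rw [Nat.choose_eq_zero_of_lt (by simpa using this)]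
    simp
  rw [h, Finset.mul_sum]
  refine Finset.sum_congr rfl fun j _ => ?_
  simp
  ring

/-! ### Expansion of the kernel into zonal harmonics -/

/-- The coefficients of the zonal harmonics: the polynomial
`∑ κ, zonalCoeff κ * ⟨z,w⟩ ^ (p - κ) * ⟨w,z⟩ ^ (q - κ) * (|z|² |w|²) ^ κ` is harmonic in `z`. -/
def zonalCoeff (n p q : ℕ) : ℕ → ℝ
  | 0 => 1
  | κ + 1 => -(((p : ℝ) - κ) * (q - κ) / ((κ + 1) * (p + q - κ - 2 + n))) * zonalCoeff n p q κ

theorem zonalCoeff_eq_zero (n p q κ : ℕ) (h : p < κ ∨ q < κ) : zonalCoeff n p q κ = 0 := by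
  induction κ with
  | zero => omega
  | succ κ ih =>
    rw [zonalCoeff]
    by_cases h' : p < κ ∨ q < κ
    · rw [ih h', mul_zero]
    · rcases (by omega : p = κ ∨ q = κ) with rfl | rfl <;> simp

/-- The denominator p+q-κ-2+n is positive while κ < min p q. From there on both sides vanish, so
division by zero does no harm. -/
theorem zonalCoeff_succ (n p q κ : ℕ) (hn : 1 ≤ n) :
    zonalCoeff n p q (κ + 1) * ((κ + 1) * (p + q - κ - 2 + n)) =
      -((p : ℝ) - κ) * (q - κ) * zonalCoeff n p q κ := by
  by_cases h : κ < p ∧ κ < q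
  · have h1 : (κ : ℝ) + 1 ≤ p := by exact_mod_cast h.1
    have h2 : (κ : ℝ) + 1 ≤ q := by exact_mod_cast h.2
    have h3 : (1 : ℝ) ≤ n := by exact_mod_cast hn
    have h4 : (0 : ℝ) ≤ κ := by positivity
    have h5 : (p : ℝ) + q - κ - 2 + n ≠ 0 := by linarith
    have h6 : (κ : ℝ) + 1 ≠ 0 := by positivity
    rw [zonalCoeff]
    field_simp
  · rw [zonalCoeff_eq_zero n p q (κ + 1) (by omega), zero_mul]
    rcases (by omega : (p < κ ∨ q < κ) ∨ p = κ ∨ q = κ) with h | rfl | rfl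
    · rw [zonalCoeff_eq_zero n p q κ h, mul_zero]
    · simp
    · simp

/-- The factor of `s ^ α * t ^ β * a ^ κ` in the expansion into zonal harmonics. -/
def zonalWeight (n m k : ℕ) (b : ℝ) (α β κ : ℕ) : ℝ :=
  kernelBase n m k (α + κ) (β + κ) * zonalCoeff n (α + κ) (β + κ) κ * b ^ κ *
    radialPoly n m k (α + κ) (β + κ) b

/-- Both sides belong to the same bidegree (α+κ+1, β+κ+1), so only the recurrence of the zonal
coefficients, that is harmonicity, is involved. -/
theorem zonalWeight_succ (n m k : ℕ) (b : ℝ) (α β κ : ℕ) (hn : 1 ≤ n) :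
    b * (α + 1) * (β + 1) * zonalWeight n m k b (α + 1) (β + 1) κ =
      -((κ : ℝ) + 1) * (α + β + κ + n) * zonalWeight n m k b α β (κ + 1) := by
  have h := zonalCoeff_succ n (α + κ + 1) (β + κ + 1) κ hn
  simp only [zonalWeight]
  rw [show α + 1 + κ = α + κ + 1 by ring, show β + 1 + κ = β + κ + 1 by ring,
    show α + (κ + 1) = α + κ + 1 by ring, show β + (κ + 1) = β + κ + 1 by ring]
  push_cast at h
  linear_combination b ^ (κ + 1) * kernelBase n m k (α + κ + 1) (β + κ + 1) *
    radialPoly n m k (α + κ + 1) (β + κ + 1) b * h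

/-- Uniqueness for the recurrence in i: both sides satisfy `kernelCoeff_rec`, whose leading factor
(i+1)(α+β+i+n) is nonzero, and they agree at i = 0 by `kernelCoeff_zero_right`. -/
theorem kernelCoeff_eq_sum_zonalWeight (n m k : ℕ) (b : ℝ) (hn : 1 ≤ n) (i α β : ℕ) :
    kernelCoeff n m k b α β i = ∑ κ ∈ Finset.range (i + 1),
      zonalWeight n m k b α β κ * radialCoeff n m k (α + κ) (β + κ) (i - κ) := by
  induction i generalizing α β with
  | zero =>
    simp [kernelCoeff_zero_right n m k α β b hn, zonalWeight, zonalCoeff, radialCoeff_zero]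
  | succ i ih =>
    have hn' : (1 : ℝ) ≤ n := by exact_mod_cast hn
    have h0 : ((i : ℝ) + 1) * (α + β + i + n) ≠ 0 := by positivity
    have h1 := kernelCoeff_rec n m k b α β i
    rw [ih, ih] at h1
    apply mul_left_cancel₀ h0
    have e1 : b * (α + 1) * (β + 1) * ∑ κ ∈ Finset.range (i + 1),
        zonalWeight n m k b (α + 1) (β + 1) κ *
          radialCoeff n m k (α + 1 + κ) (β + 1 + κ) (i - κ) =
        -∑ κ ∈ Finset.range (i + 2), (κ : ℝ) * (α + β + κ - 1 + n) *
          (zonalWeight n m k b α β κ * radialCoeff n m k (α + κ) (β + κ) (i + 1 - κ)) := by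
      rw [Finset.sum_range_succ' _ (i + 1), Finset.mul_sum]
      simp only [CharP.cast_eq_zero, zero_mul, add_zero]
      rw [← Finset.sum_neg_distrib]
      refine Finset.sum_congr rfl fun κ _ => ?_
      have h := zonalWeight_succ n m k b α β κ hn
      rw [show α + 1 + κ = α + (κ + 1) by ring, show β + 1 + κ = β + (κ + 1) by ring,
        show i + 1 - (κ + 1) = i - κ by omega]
      push_cast
      linear_combination radialCoeff n m k (α + (κ + 1)) (β + (κ + 1)) (i - κ) * h
    have e2 : ((α : ℝ) + i - m) * ((β : ℝ) + i - m - k) * ∑ κ ∈ Finset.range (i + 1),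
        zonalWeight n m k b α β κ * radialCoeff n m k (α + κ) (β + κ) (i - κ) =
        -∑ κ ∈ Finset.range (i + 2), ((i : ℝ) + 1 - κ) * (n + α + β + κ + i) *
          (zonalWeight n m k b α β κ * radialCoeff n m k (α + κ) (β + κ) (i + 1 - κ)) := by
      rw [Finset.sum_range_succ _ (i + 1), Finset.mul_sum]
      have h : (i : ℝ) + 1 - ((i + 1 : ℕ) : ℝ) = 0 := by push_cast; ring
      rw [h, zero_mul, zero_mul, add_zero, ← Finset.sum_neg_distrib]
      refine Finset.sum_congr rfl fun κ hκ => ?_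
      have hκ : κ ≤ i := by simpa [Nat.lt_succ_iff] using hκ
      obtain ⟨I, rfl⟩ := Nat.exists_eq_add_of_le hκ
      have h := radialCoeff_succ n m k (α + κ) (β + κ) I hn
      rw [show κ + I - κ = I by omega, show κ + I + 1 - κ = I + 1 by omega]
      push_cast at *
      linear_combination zonalWeight n m k b α β κ * h
    rw [e1, e2] at h1
    -- The leading factor splits into a zonal and a radial part: (i+1)(α+β+i+n) = κ(α+β+κ-1+n) +
    -- (i+1-κ)(n+α+β+κ+i).
    have e3 : (((i + 1 : ℕ) : ℝ)) * (α + β + i + n) * ∑ κ ∈ Finset.range (i + 2),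
        zonalWeight n m k b α β κ * radialCoeff n m k (α + κ) (β + κ) (i + 1 - κ) =
        ∑ κ ∈ Finset.range (i + 2), (κ : ℝ) * (α + β + κ - 1 + n) *
          (zonalWeight n m k b α β κ * radialCoeff n m k (α + κ) (β + κ) (i + 1 - κ)) +
        ∑ κ ∈ Finset.range (i + 2), ((i : ℝ) + 1 - κ) * (n + α + β + κ + i) *
          (zonalWeight n m k b α β κ * radialCoeff n m k (α + κ) (β + κ) (i + 1 - κ)) := by
      rw [Finset.mul_sum, ← Finset.sum_add_distrib]
      refine Finset.sum_congr rfl fun κ _ => ?_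
      push_cast
      ring
    push_cast at e3
    linear_combination h1 - e3

theorem sum_range_shift {M : Type*} [AddCommMonoid M] (P κ : ℕ) (G : ℕ → M)
    (hG : ∀ α, P ≤ α + κ → G α = 0) :
    ∑ p ∈ Finset.range P, (if κ ≤ p then G (p - κ) else 0) = ∑ α ∈ Finset.range P, G α := by
  rcases le_or_gt κ P with h | h
  · obtain ⟨P, rfl⟩ := Nat.exists_eq_add_of_le h
    rw [Finset.sum_range_add, Finset.sum_eq_zero, zero_add]
    · simp only [Nat.le_add_right, if_true, Nat.add_sub_cancel_left]
      refine Finset.sum_subset (Finset.range_mono (by omega)) fun α _ hα => hG α ?_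
      have : P ≤ α := by simpa using hα
      omega
    · intro p hp
      rw [if_neg (by simpa using hp)]
  · rw [Finset.sum_eq_zero, Finset.sum_eq_zero]
    · exact fun α _ => hG α (by omega)
    · intro p hp
      have := Finset.mem_range.1 hp
      rw [if_neg (by omega)]

/-- Substitution p = α + κ, q = β + κ. The box of new indices is larger than the image, but the
terms outside vanish. -/
theorem sum_range_diag_reindex {M : Type*} [AddCommMonoid M] (P Q : ℕ) (g : ℕ → ℕ → ℕ → M)
    (hP : ∀ α β κ, P ≤ α + κ → g α β κ = 0) (hQ : ∀ α β κ, Q ≤ β + κ → g α β κ = 0) :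
    ∑ p ∈ Finset.range P, ∑ q ∈ Finset.range Q, ∑ κ ∈ Finset.range (min p q + 1),
      g (p - κ) (q - κ) κ =
    ∑ α ∈ Finset.range P, ∑ β ∈ Finset.range Q, ∑ κ ∈ Finset.range P, g α β κ := by
  have h1 : ∀ p ∈ Finset.range P, ∀ q ∈ Finset.range Q,
      ∑ κ ∈ Finset.range (min p q + 1), g (p - κ) (q - κ) κ =
      ∑ κ ∈ Finset.range P,
        if κ ≤ p then (if κ ≤ q then g (p - κ) (q - κ) κ else 0) else 0 := by
    intro p hp q _
    have hp := Finset.mem_range.1 hp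
    symm
    refine Finset.sum_subset_zero_on_sdiff (Finset.range_mono (by omega)) (fun κ hκ => ?_)
      (fun κ hκ => ?_) |>.symm
    · have h := (Finset.mem_sdiff.1 hκ).2
      simp only [Finset.mem_range, not_lt] at h
      split_ifs <;> first | rfl | omega
    · have h := Finset.mem_range.1 hκ
      rw [if_pos (by omega), if_pos (by omega)]
  rw [Finset.sum_congr rfl fun p hp => Finset.sum_congr rfl fun q hq => h1 p hp q hq]
  have h2 : ∀ κ, ∑ p ∈ Finset.range P, ∑ q ∈ Finset.range Q,
      (if κ ≤ p then (if κ ≤ q then g (p - κ) (q - κ) κ else 0) else 0) =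
      ∑ α ∈ Finset.range P, ∑ β ∈ Finset.range Q, g α β κ := by
    intro κ
    rw [← sum_range_shift P κ (fun α => ∑ β ∈ Finset.range Q, g α β κ)
      fun α h => Finset.sum_eq_zero fun β _ => hP α β κ h]
    refine Finset.sum_congr rfl fun p _ => ?_
    split_ifs with h
    · exact sum_range_shift Q κ (fun β => g (p - κ) β κ) fun β hβ => hQ _ β κ hβ
    · simp
  have h3 : ∀ F : ℕ → ℕ → ℕ → M,
      ∑ p ∈ Finset.range P, ∑ q ∈ Finset.range Q, ∑ κ ∈ Finset.range P, F p q κ =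
      ∑ κ ∈ Finset.range P, ∑ p ∈ Finset.range P, ∑ q ∈ Finset.range Q, F p q κ := by
    intro F
    exact (Finset.sum_congr rfl fun p _ => Finset.sum_comm).trans Finset.sum_comm
  rw [h3, h3, Finset.sum_congr rfl fun κ _ => h2 κ]

theorem one_add_pow_eq_sum {R : Type*} [CommSemiring R] (x : R) {l N : ℕ} (h : l ≤ N) :
    (1 + x) ^ l = ∑ j ∈ Finset.range (N + 1), (l.choose j : R) * x ^ j := by
  rw [add_comm, add_pow]
  refine Finset.sum_subset_zero_on_sdiff (Finset.range_mono (by omega)) (fun j hj => ?_)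
    (fun j _ => by rw [one_pow, mul_one, mul_comm])
  have := (Finset.mem_sdiff.1 hj).2
  rw [Nat.choose_eq_zero_of_lt (by simpa using this)]
  simp

/-- The zonal harmonic of bidegree `(p, q)` in terms of `s = ⟨z,w⟩`, `t = ⟨w,z⟩` and
`r = |z|² |w|²`, normalized to have leading term `s ^ p * t ^ q`. -/
def zonalPoly (n p q : ℕ) (s t r : ℂ) : ℂ :=
  ∑ κ ∈ Finset.range (min p q + 1), (zonalCoeff n p q κ : ℂ) * s ^ (p - κ) * t ^ (q - κ) * r ^ κ

theorem sum_jacobiCoeff_eq_sum_kernelCoeff (n m k : ℕ) (a b : ℝ) (s t : ℂ) :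
    ∑ l ∈ Finset.range (m + 1), (jacobiCoeff n m k l : ℂ) * (1 + s) ^ l * (1 + t) ^ (l + k) *
      ((1 + a) * (1 + b)) ^ (m - l) =
    ∑ α ∈ Finset.range (m + 1), ∑ β ∈ Finset.range (m + k + 1), ∑ i ∈ Finset.range (m + 1),
      (kernelCoeff n m k b α β i : ℂ) * s ^ α * t ^ β * (a : ℂ) ^ i := by
  have h : ∀ l ∈ Finset.range (m + 1), (jacobiCoeff n m k l : ℂ) * (1 + s) ^ l *
      (1 + t) ^ (l + k) * ((1 + a) * (1 + b)) ^ (m - l) =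
      ∑ α ∈ Finset.range (m + 1), ∑ β ∈ Finset.range (m + k + 1), ∑ i ∈ Finset.range (m + 1),
        ((jacobiCoeff n m k l * (l.choose α : ℝ) * ((l + k).choose β : ℝ) *
          ((m - l).choose i : ℝ) * (1 + b) ^ (m - l) : ℝ) : ℂ) * s ^ α * t ^ β * (a : ℂ) ^ i := by
    intro l hl
    have hl := Finset.mem_range.1 hl
    rw [one_add_pow_eq_sum s (show l ≤ m by omega),
      one_add_pow_eq_sum t (show l + k ≤ m + k by omega), mul_pow,
      one_add_pow_eq_sum (a : ℂ) (show m - l ≤ m by omega)]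
    calc _ = (jacobiCoeff n m k l : ℂ) * (1 + b) ^ (m - l) *
          ((∑ α ∈ Finset.range (m + 1), (l.choose α : ℂ) * s ^ α) *
            ((∑ β ∈ Finset.range (m + k + 1), ((l + k).choose β : ℂ) * t ^ β) *
              ∑ i ∈ Finset.range (m + 1), ((m - l).choose i : ℂ) * (a : ℂ) ^ i)) := by ring
      _ = _ := by
        rw [Finset.sum_mul_sum, Finset.sum_mul_sum]
        simp only [Finset.mul_sum]
        refine Finset.sum_congr rfl fun α _ => Finset.sum_congr rfl fun β _ =>
          Finset.sum_congr rfl fun i _ => ?_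
        push_cast
        ring
  rw [Finset.sum_congr rfl h]
  simp only [kernelCoeff, Complex.ofReal_sum, Finset.sum_mul]
  exact Finset.sum_comm.trans <| Finset.sum_congr rfl fun α _ => Finset.sum_comm.trans <|
    Finset.sum_congr rfl fun β _ => Finset.sum_comm

theorem sum_kernelBase_mul_zonalPoly (n m k : ℕ) (hn : 1 ≤ n) (a b : ℝ) (s t : ℂ) :
    ∑ p ∈ Finset.range (m + 1), ∑ q ∈ Finset.range (m + k + 1),
      ((kernelBase n m k p q * radialPoly n m k p q a * radialPoly n m k p q b : ℝ) : ℂ) *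
        zonalPoly n p q s t (a * b) =
    ∑ l ∈ Finset.range (m + 1), (jacobiCoeff n m k l : ℂ) * (1 + s) ^ l * (1 + t) ^ (l + k) *
      ((1 + a) * (1 + b)) ^ (m - l) := by
  let g : ℕ → ℕ → ℕ → ℂ := fun α β κ => (zonalWeight n m k b α β κ : ℂ) *
    ((a ^ κ * radialPoly n m k (α + κ) (β + κ) a : ℝ) : ℂ) * s ^ α * t ^ β
  rw [sum_jacobiCoeff_eq_sum_kernelCoeff]
  have h1 : ∀ p q, ((kernelBase n m k p q * radialPoly n m k p q a *
      radialPoly n m k p q b : ℝ) : ℂ) * zonalPoly n p q s t (a * b) =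
      ∑ κ ∈ Finset.range (min p q + 1), g (p - κ) (q - κ) κ := by
    intro p q
    rw [zonalPoly, Finset.mul_sum]
    refine Finset.sum_congr rfl fun κ hκ => ?_
    have hκ := Finset.mem_range.1 hκ
    simp only [g, zonalWeight]
    rw [Nat.sub_add_cancel (show κ ≤ p by omega), Nat.sub_add_cancel (show κ ≤ q by omega)]
    push_cast
    ring
  simp only [h1]
  have hP : ∀ α β κ, m + 1 ≤ α + κ → zonalWeight n m k b α β κ = 0 := fun α β κ h => by
    rw [zonalWeight, kernelBase_eq_zero_left _ _ _ _ _ (by omega)]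
    simp
  have hQ : ∀ α β κ, m + k + 1 ≤ β + κ → zonalWeight n m k b α β κ = 0 := fun α β κ h => by
    rw [zonalWeight, kernelBase_eq_zero_right _ _ _ _ _ (by omega)]
    simp
  rw [sum_range_diag_reindex (m + 1) (m + k + 1) g (fun α β κ h => by simp [g, hP α β κ h])
    (fun α β κ h => by simp [g, hQ α β κ h])]
  refine Finset.sum_congr rfl fun α _ => Finset.sum_congr rfl fun β _ => ?_
  have h2 : ∑ i ∈ Finset.range (m + 1), kernelCoeff n m k b α β i * a ^ i =
      ∑ κ ∈ Finset.range (m + 1), zonalWeight n m k b α β κ *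
        (a ^ κ * radialPoly n m k (α + κ) (β + κ) a) := by
    have h3 := Finset.sum_range_diag_flip (m + 1) fun κ I =>
      zonalWeight n m k b α β κ * radialCoeff n m k (α + κ) (β + κ) I * a ^ (κ + I)
    rw [Finset.sum_congr rfl fun i _ => by rw [kernelCoeff_eq_sum_zonalWeight n m k b hn i α β]]
    calc _ = _ := Finset.sum_congr rfl fun i _ => by
            rw [Finset.sum_mul]
            exact Finset.sum_congr rfl fun κ hκ => by
              rw [Nat.add_sub_cancel' (show κ ≤ i by have := Finset.mem_range.1 hκ; omega)]
      _ = _ := h3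
      _ = _ := Finset.sum_congr rfl fun κ _ => ?_
    by_cases hκ : m + 1 ≤ α + κ
    · simp [hP α β κ hκ]
    · rw [radialPoly, Finset.mul_sum, Finset.mul_sum]
      refine Finset.sum_subset_zero_on_sdiff (Finset.range_mono (by omega)) (fun I hI => ?_)
        fun I _ => by rw [pow_add]; ring
      have := (Finset.mem_sdiff.1 hI).2
      simp only [Finset.mem_range, not_lt] at this
      rw [radialCoeff_eq_zero n m k (α + κ) (β + κ) I (by omega) (by omega)]
      simp
  have h4 := congrArg (fun x : ℝ => (x : ℂ) * (s ^ α * t ^ β)) h2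
  simp only [Complex.ofReal_sum, Finset.sum_mul] at h4
  calc _ = _ := Finset.sum_congr rfl fun κ _ => by simp only [g]; push_cast; ring
    _ = _ := h4.symm
    _ = _ := Finset.sum_congr rfl fun i _ => by push_cast; ring

/-! ### Gaussian moments and harmonic polynomials -/

open MvPolynomial in
/-- The linear functional on polynomials in `z` and `z̄` given by integration against the
probability measure with density `π⁻ⁿ exp (-|z|²)`. -/
def gaussMoment (n : ℕ) : MvPolynomial (Fin n ⊕ Fin n) ℂ →ₗ[ℂ] ℂ :=
  (basisMonomials (Fin n ⊕ Fin n) ℂ).constr ℂ fun d =>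
    ∏ i, if d (Sum.inl i) = d (Sum.inr i) then ((d (Sum.inl i)).factorial : ℂ) else 0

namespace MvPolynomial

variable {n : ℕ}

theorem gaussMoment_monomial (d : Fin n ⊕ Fin n →₀ ℕ) (c : ℂ) :
    gaussMoment n (monomial d c) = c *
      ∏ i, if d (Sum.inl i) = d (Sum.inr i) then ((d (Sum.inl i)).factorial : ℂ) else 0 := by
  have h : monomial d c = c • basisMonomials (Fin n ⊕ Fin n) ℂ d := by
    rw [coe_basisMonomials, smul_monomial, smul_eq_mul, mul_one]
  rw [h, map_smul, gaussMoment, Module.Basis.constr_basis, smul_eq_mul]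

/-- Gaussian integration by parts; on monomials it is (e+1)! = (e+1)·e!. -/
theorem gaussMoment_X_inl_mul (i : Fin n) (P : MvPolynomial (Fin n ⊕ Fin n) ℂ) :
    gaussMoment n (X (Sum.inl i) * P) = gaussMoment n (pderiv (Sum.inr i) P) := by
  induction P using MvPolynomial.induction_on' with
  | add p q hp hq => rw [mul_add, map_add, map_add, map_add, hp, hq]
  | monomial d c =>
    rw [pderiv_monomial, X, monomial_mul, gaussMoment_monomial, gaussMoment_monomial, one_mul,
      mul_assoc, ← Finset.mul_prod_erase _ _ (Finset.mem_univ i),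
      ← Finset.mul_prod_erase _ _ (Finset.mem_univ i), ← mul_assoc ((d (Sum.inr i) : ℕ) : ℂ)]
    congr 2
    · simp only [Finsupp.coe_add, Pi.add_apply, Finsupp.coe_tsub, Pi.sub_apply,
        Finsupp.single_eq_same]
      rw [Finsupp.single_eq_of_ne (by simp), Finsupp.single_eq_of_ne (by simp)]
      rcases hd : d (Sum.inr i) with _ | e
      · simp
      · by_cases h : d (Sum.inl i) = e
        · rw [if_pos (by omega), if_pos (by omega), h, add_comm 1 e, Nat.factorial_succ]
          simp
        · rw [if_neg (by omega), if_neg (by omega), mul_zero]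
    · refine Finset.prod_congr rfl fun j hj => ?_
      have hji : j ≠ i := Finset.ne_of_mem_erase hj
      simp [hji.symm]

theorem gaussMoment_X_inr_mul (i : Fin n) (P : MvPolynomial (Fin n ⊕ Fin n) ℂ) :
    gaussMoment n (X (Sum.inr i) * P) = gaussMoment n (pderiv (Sum.inl i) P) := by
  induction P using MvPolynomial.induction_on' with
  | add p q hp hq => rw [mul_add, map_add, map_add, map_add, hp, hq]
  | monomial d c =>
    rw [pderiv_monomial, X, monomial_mul, gaussMoment_monomial, gaussMoment_monomial, one_mul,
      mul_assoc, ← Finset.mul_prod_erase _ _ (Finset.mem_univ i),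
      ← Finset.mul_prod_erase _ _ (Finset.mem_univ i), ← mul_assoc ((d (Sum.inl i) : ℕ) : ℂ)]
    congr 2
    · simp only [Finsupp.coe_add, Pi.add_apply, Finsupp.coe_tsub, Pi.sub_apply,
        Finsupp.single_eq_same]
      rw [Finsupp.single_eq_of_ne (by simp), Finsupp.single_eq_of_ne (by simp)]
      rcases hd : d (Sum.inl i) with _ | e
      · simp [show ¬ 0 = 1 + d (Sum.inr i) by omega]
      · by_cases h : d (Sum.inr i) = e
        · rw [if_pos (by omega), if_pos (by omega), zero_add, Nat.add_sub_cancel,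
            Nat.factorial_succ]
          simp
        · rw [if_neg (by omega), if_neg (by omega), mul_zero]
    · refine Finset.prod_congr rfl fun j hj => ?_
      have hji : j ≠ i := Finset.ne_of_mem_erase hj
      simp [hji.symm]

theorem pderiv_pderiv_comm {σ R : Type*} [CommSemiring R] (i j : σ) (P : MvPolynomial σ R) :
    pderiv i (pderiv j P) = pderiv j (pderiv i P) := by
  classical
  ext d
  simp only [coeff_pderiv, Finsupp.add_apply, Finsupp.single_apply]
  rw [add_right_comm]
  rcases eq_or_ne i j with rfl | h
  · rfl
  · simp [h, h.symm]
    ring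

/-- The linear form `∑ i, c i * X (e i)`. -/
def linForm (e : Fin n → Fin n ⊕ Fin n) (c : Fin n → ℂ) : MvPolynomial (Fin n ⊕ Fin n) ℂ :=
  ∑ i, C (c i) * X (e i)

/-- The directional derivative `∑ i, c i * ∂ / ∂X (e i)`. -/
def dirDeriv (e : Fin n → Fin n ⊕ Fin n) (c : Fin n → ℂ) (P : MvPolynomial (Fin n ⊕ Fin n) ℂ) :
    MvPolynomial (Fin n ⊕ Fin n) ℂ :=
  ∑ i, C (c i) * pderiv (e i) P

theorem dirDeriv_mul (e : Fin n → Fin n ⊕ Fin n) (c : Fin n → ℂ)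
    (P Q : MvPolynomial (Fin n ⊕ Fin n) ℂ) :
    dirDeriv e c (P * Q) = dirDeriv e c P * Q + P * dirDeriv e c Q := by
  simp only [dirDeriv, Finset.sum_mul, Finset.mul_sum, ← Finset.sum_add_distrib]
  refine Finset.sum_congr rfl fun i _ => ?_
  rw [pderiv_mul]
  ring

theorem dirDeriv_pow (e : Fin n → Fin n ⊕ Fin n) (c : Fin n → ℂ)
    (P : MvPolynomial (Fin n ⊕ Fin n) ℂ) (N : ℕ) :
    dirDeriv e c (P ^ N) = N * P ^ (N - 1) * dirDeriv e c P := by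
  simp only [dirDeriv, Finset.mul_sum]
  refine Finset.sum_congr rfl fun i _ => ?_
  rw [pderiv_pow]
  ring

theorem pderiv_linForm_self (e : Fin n → Fin n ⊕ Fin n) (he : Function.Injective e)
    (c : Fin n → ℂ) (i : Fin n) : pderiv (e i) (linForm e c) = C (c i) := by
  classical
  simp only [linForm, map_sum, pderiv_C_mul, pderiv_X, Pi.single_apply, he.eq_iff]
  simp

theorem pderiv_linForm_of_ne (e : Fin n → Fin n ⊕ Fin n) (c : Fin n → ℂ) (j : Fin n ⊕ Fin n)
    (h : ∀ i, e i ≠ j) : pderiv j (linForm e c) = 0 := by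
  classical
  simp only [linForm, map_sum, pderiv_C_mul]
  exact Finset.sum_eq_zero fun i _ => by rw [pderiv_X_of_ne (h i), mul_zero]

theorem gaussMoment_linForm_inl_mul (c : Fin n → ℂ) (P : MvPolynomial (Fin n ⊕ Fin n) ℂ) :
    gaussMoment n (linForm Sum.inl c * P) = gaussMoment n (dirDeriv Sum.inr c P) := by
  simp only [linForm, dirDeriv, Finset.sum_mul, map_sum, ← smul_eq_C_mul, smul_mul_assoc, map_smul,
    gaussMoment_X_inl_mul]

theorem gaussMoment_linForm_inr_mul (c : Fin n → ℂ) (P : MvPolynomial (Fin n ⊕ Fin n) ℂ) :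
    gaussMoment n (linForm Sum.inr c * P) = gaussMoment n (dirDeriv Sum.inl c P) := by
  simp only [linForm, dirDeriv, Finset.sum_mul, map_sum, ← smul_eq_C_mul, smul_mul_assoc, map_smul,
    gaussMoment_X_inr_mul]

theorem complexLaplacian_apply (P : MvPolynomial (Fin n ⊕ Fin n) ℂ) :
    complexLaplacian n P = ∑ j, pderiv (Sum.inl j) (pderiv (Sum.inr j) P) := by
  simp [complexLaplacian]

theorem complexLaplacian_pderiv (i : Fin n ⊕ Fin n) (P : MvPolynomial (Fin n ⊕ Fin n) ℂ) :
    complexLaplacian n (pderiv i P) = pderiv i (complexLaplacian n P) := by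
  simp only [complexLaplacian_apply, map_sum]
  exact Finset.sum_congr rfl fun j _ => by
    rw [pderiv_pderiv_comm (Sum.inr j) i, pderiv_pderiv_comm (Sum.inl j) i]

theorem mem_bihomHarmonic {p q : ℕ} {P : MvPolynomial (Fin n ⊕ Fin n) ℂ} :
    P ∈ bihomHarmonic n p q ↔
      IsWeightedHomogeneous (bidegreeWeight n) P (p, q) ∧ complexLaplacian n P = 0 := by
  rw [bihomHarmonic, Submodule.mem_inf, mem_weightedHomogeneousSubmodule, LinearMap.mem_ker]

theorem dirDeriv_inl_mem {p q : ℕ} {P : MvPolynomial (Fin n ⊕ Fin n) ℂ} (c : Fin n → ℂ)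
    (h : P ∈ bihomHarmonic n (p + 1) q) : dirDeriv Sum.inl c P ∈ bihomHarmonic n p q := by
  refine Submodule.sum_mem _ fun i _ => ?_
  rw [← smul_eq_C_mul]
  refine Submodule.smul_mem _ _ (mem_bihomHarmonic.2 ⟨?_, ?_⟩)
  · exact (mem_bihomHarmonic.1 h).1.pderiv (by simp [bidegreeWeight])
  · rw [complexLaplacian_pderiv, (mem_bihomHarmonic.1 h).2, map_zero]

theorem dirDeriv_inr_mem {p q : ℕ} {P : MvPolynomial (Fin n ⊕ Fin n) ℂ} (c : Fin n → ℂ)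
    (h : P ∈ bihomHarmonic n p (q + 1)) : dirDeriv Sum.inr c P ∈ bihomHarmonic n p q := by
  refine Submodule.sum_mem _ fun i _ => ?_
  rw [← smul_eq_C_mul]
  refine Submodule.smul_mem _ _ (mem_bihomHarmonic.2 ⟨?_, ?_⟩)
  · exact (mem_bihomHarmonic.1 h).1.pderiv (by simp [bidegreeWeight])
  · rw [complexLaplacian_pderiv, (mem_bihomHarmonic.1 h).2, map_zero]

theorem IsWeightedHomogeneous.map_weight {σ R M N : Type*} [CommSemiring R] [AddCommMonoid M]
    [AddCommMonoid N] {w : σ → M} {P : MvPolynomial σ R} {d : M}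
    (h : IsWeightedHomogeneous w P d) (f : M →+ N) :
    IsWeightedHomogeneous (fun i => f (w i)) P (f d) := by
  intro e he
  rw [← h he, Finsupp.weight_apply, Finsupp.weight_apply, map_finsuppSum]
  simp

theorem sum_X_inl_mul_pderiv {p q : ℕ} {P : MvPolynomial (Fin n ⊕ Fin n) ℂ}
    (h : IsWeightedHomogeneous (bidegreeWeight n) P (p, q)) :
    ∑ i, X (Sum.inl i) * pderiv (Sum.inl i) P = p • P := by
  have h1 := (h.map_weight (AddMonoidHom.fst ℕ ℕ)).sum_weight_X_mul_pderiv
  simpa [bidegreeWeight] using h1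

theorem sum_X_inr_mul_pderiv {p q : ℕ} {P : MvPolynomial (Fin n ⊕ Fin n) ℂ}
    (h : IsWeightedHomogeneous (bidegreeWeight n) P (p, q)) :
    ∑ i, X (Sum.inr i) * pderiv (Sum.inr i) P = q • P := by
  have h1 := (h.map_weight (AddMonoidHom.snd ℕ ℕ)).sum_weight_X_mul_pderiv
  simpa [bidegreeWeight] using h1

/-- By Euler's identity and integration by parts, p times the moment of P is the moment of ∑ z_i
∂P/∂z_i, hence that of ΔP = 0; likewise with q. -/
theorem gaussMoment_eq_zero_of_harmonic {p q : ℕ} {P : MvPolynomial (Fin n ⊕ Fin n) ℂ}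
    (h : P ∈ bihomHarmonic n p q) (hpq : p ≠ 0 ∨ q ≠ 0) : gaussMoment n P = 0 := by
  obtain ⟨h1, h2⟩ := mem_bihomHarmonic.1 h
  rw [complexLaplacian_apply] at h2
  rcases hpq with hp | hq
  · have e := congrArg (gaussMoment n) (sum_X_inl_mul_pderiv h1)
    simp only [map_sum, gaussMoment_X_inl_mul, map_nsmul] at e
    simp only [pderiv_pderiv_comm (Sum.inr _) (Sum.inl _)] at e
    rw [← map_sum, h2, map_zero] at e
    simpa [hp] using e.symm
  · have e := congrArg (gaussMoment n) (sum_X_inr_mul_pderiv h1)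
    simp only [map_sum, gaussMoment_X_inr_mul, map_nsmul] at e
    rw [← map_sum, h2, map_zero] at e
    simpa [hq] using e.symm

theorem eq_C_of_bidegree_zero {P : MvPolynomial (Fin n ⊕ Fin n) ℂ}
    (h : IsWeightedHomogeneous (bidegreeWeight n) P (0, 0)) : P = C (coeff 0 P) := by
  classical
  ext d
  rw [coeff_C]
  split_ifs with hd
  · rw [hd]
  · by_contra hc
    apply hd
    have h1 := h hc
    rw [Finsupp.weight_eq_sum, Prod.ext_iff] at h1
    ext i
    simp [bidegreeWeight, Prod.fst_sum, Prod.snd_sum] at h1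
    rcases i with i | i
    · simp [h1.1 i]
    · simp [h1.2 i]

theorem evalConj_dirDeriv_inr {p q : ℕ} {P : MvPolynomial (Fin n ⊕ Fin n) ℂ}
    (h : IsWeightedHomogeneous (bidegreeWeight n) P (p, q)) (w : EuclideanSpace ℂ (Fin n)) :
    evalConj (dirDeriv Sum.inr (fun i => conj (w i)) P) w = q * evalConj P w := by
  have e := congrArg (fun Q => evalConj Q w) (sum_X_inr_mul_pderiv h)
  simpa [evalConj, dirDeriv] using e

theorem evalConj_dirDeriv_inl {p q : ℕ} {P : MvPolynomial (Fin n ⊕ Fin n) ℂ}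
    (h : IsWeightedHomogeneous (bidegreeWeight n) P (p, q)) (w : EuclideanSpace ℂ (Fin n)) :
    evalConj (dirDeriv Sum.inl (fun i => w i) P) w = p * evalConj P w := by
  have e := congrArg (fun Q => evalConj Q w) (sum_X_inl_mul_pderiv h)
  simpa [evalConj, dirDeriv] using e

theorem dirDeriv_linForm_self (e : Fin n → Fin n ⊕ Fin n) (he : Function.Injective e)
    (c c' : Fin n → ℂ) : dirDeriv e c (linForm e c') = C (∑ i, c i * c' i) := by
  simp only [dirDeriv, pderiv_linForm_self e he, map_sum, map_mul]

/-- Each linear factor is moved onto P as a directional derivative, which keeps P harmonic and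
lowers its bidegree. If some degree of P is left over the moment vanishes; otherwise Euler's
identity at w produces p! q! P(w). -/
theorem gaussMoment_mul_linForm_pow (w : EuclideanSpace ℂ (Fin n)) (B : ℕ) :
    ∀ (A p q : ℕ) (P : MvPolynomial (Fin n ⊕ Fin n) ℂ), P ∈ bihomHarmonic n p q → A ≤ p → B ≤ q →
      gaussMoment n (P * linForm Sum.inr (fun i => w i) ^ A *
        linForm Sum.inl (fun i => conj (w i)) ^ B) =
      if A = p ∧ B = q then (p.factorial * q.factorial : ℂ) * evalConj P w else 0 := by
  have hinl : Function.Injective (Sum.inl : Fin n → Fin n ⊕ Fin n) := Sum.inl_injective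
  have hinr : Function.Injective (Sum.inr : Fin n → Fin n ⊕ Fin n) := Sum.inr_injective
  induction B with
  | zero =>
    intro A
    induction A with
    | zero =>
      intro p q P hP _ _
      rw [pow_zero, pow_zero, mul_one, mul_one]
      split_ifs with h
      · obtain ⟨rfl, rfl⟩ := h
        rw [eq_C_of_bidegree_zero (mem_bihomHarmonic.1 hP).1, ← monomial_zero',
          gaussMoment_monomial]
        simp [evalConj]
      · exact gaussMoment_eq_zero_of_harmonic hP (by omega)
    | succ A ih =>
      intro p q P hP hA hB
      obtain ⟨p, rfl⟩ := Nat.exists_eq_succ_of_ne_zero (show p ≠ 0 by omega)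
      have e1 : P * linForm Sum.inr (fun i => w i) ^ (A + 1) *
          linForm Sum.inl (fun i => conj (w i)) ^ 0 =
          linForm Sum.inr (fun i => w i) * (P * linForm Sum.inr (fun i => w i) ^ A) := by ring
      have e2 : dirDeriv Sum.inl (fun i => w i) (linForm Sum.inr (fun i => w i)) = 0 :=
        Finset.sum_eq_zero fun i _ => by
          rw [pderiv_linForm_of_ne Sum.inr _ _ (by simp), mul_zero]
      have h := ih p q _ (dirDeriv_inl_mem (fun i => w i) hP) (by omega) hB
      rw [pow_zero, mul_one] at h
      rw [e1, gaussMoment_linForm_inr_mul, dirDeriv_mul, dirDeriv_pow, e2, mul_zero, mul_zero,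
        add_zero, h, evalConj_dirDeriv_inl (mem_bihomHarmonic.1 hP).1]
      simp only [Nat.succ_eq_add_one, add_left_inj, Nat.factorial_succ]
      split_ifs
      · push_cast; ring
      · rfl
  | succ B ih =>
    intro A p q P hP hA hB
    obtain ⟨q, rfl⟩ := Nat.exists_eq_succ_of_ne_zero (show q ≠ 0 by omega)
    have e1 : P * linForm Sum.inr (fun i => w i) ^ A *
        linForm Sum.inl (fun i => conj (w i)) ^ (B + 1) =
        linForm Sum.inl (fun i => conj (w i)) * (P * linForm Sum.inr (fun i => w i) ^ A *
          linForm Sum.inl (fun i => conj (w i)) ^ B) := by ring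
    have e2 : dirDeriv Sum.inr (fun i => conj (w i)) (linForm Sum.inl (fun i => conj (w i))) = 0 :=
      Finset.sum_eq_zero fun i _ => by
        rw [pderiv_linForm_of_ne Sum.inl _ _ (by simp), mul_zero]
    have h1 := ih A p q _ (dirDeriv_inr_mem (fun i => conj (w i)) hP) hA (by omega)
    -- The derivative also hits the opposite linear forms. That term leaves P with z̄-degree q+1
    -- against only B ≤ q factors, so it vanishes.
    have h2 : (A : ℂ) * gaussMoment n (P * linForm Sum.inr (fun i => w i) ^ (A - 1) *
        linForm Sum.inl (fun i => conj (w i)) ^ B) = 0 := by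
      rcases A with _ | A
      · simp
      · rw [ih (A + 1 - 1) p _ P hP (by omega) (by omega), if_neg (by omega), mul_zero]
    have e3 : dirDeriv Sum.inr (fun i => conj (w i)) (P * linForm Sum.inr (fun i => w i) ^ A *
        linForm Sum.inl (fun i => conj (w i)) ^ B) =
        dirDeriv Sum.inr (fun i => conj (w i)) P * linForm Sum.inr (fun i => w i) ^ A *
          linForm Sum.inl (fun i => conj (w i)) ^ B +
        (∑ i, conj (w i) * w i) • ((A : ℂ) • (P * linForm Sum.inr (fun i => w i) ^ (A - 1) *
          linForm Sum.inl (fun i => conj (w i)) ^ B)) := by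
      rw [dirDeriv_mul, dirDeriv_mul, dirDeriv_pow, dirDeriv_pow, e2,
        dirDeriv_linForm_self _ hinr, smul_eq_C_mul, smul_eq_C_mul, map_natCast C A]
      ring
    rw [e1, gaussMoment_linForm_inl_mul, e3, map_add, map_smul, map_smul, smul_eq_mul, smul_eq_mul,
      h2, mul_zero, add_zero, h1, evalConj_dirDeriv_inr (mem_bihomHarmonic.1 hP).1]
    simp only [Nat.succ_eq_add_one, add_left_inj, Nat.factorial_succ]
    split_ifs
    · push_cast; ring
    · rfl

end MvPolynomial

namespace MvPolynomial

variable {n : ℕ}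

/-! ### Zonal harmonics as harmonic polynomials -/

/-- The polynomial `∑ i, z i * z̄ i`. -/
def normSqPoly (n : ℕ) : MvPolynomial (Fin n ⊕ Fin n) ℂ :=
  ∑ i, X (Sum.inl i) * X (Sum.inr i)

theorem pderiv_inl_normSqPoly (j : Fin n) :
    pderiv (Sum.inl j) (normSqPoly n) = X (Sum.inr j) := by
  classical
  simp [normSqPoly, pderiv_X, Pi.single_apply]

theorem pderiv_inr_normSqPoly (j : Fin n) :
    pderiv (Sum.inr j) (normSqPoly n) = X (Sum.inl j) := by
  classical
  simp [normSqPoly, pderiv_X, Pi.single_apply]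

theorem natCast_mul_pow_pred {R : Type*} [CommSemiring R] (x : R) (N : ℕ) :
    (N : R) * (x * x ^ (N - 1)) = N * x ^ N := by
  rcases N with _ | N
  · simp
  · rw [Nat.add_sub_cancel, pow_succ' x N]

theorem complexLaplacian_linForm_pow_mul (c c' : Fin n → ℂ) (A B κ : ℕ) :
    complexLaplacian n (linForm Sum.inl c' ^ A * linForm Sum.inr c ^ B * normSqPoly n ^ κ) =
      (A * B : MvPolynomial (Fin n ⊕ Fin n) ℂ) * C (∑ i, c' i * c i) *
        (linForm Sum.inl c' ^ (A - 1) * linForm Sum.inr c ^ (B - 1) * normSqPoly n ^ κ) +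
      (κ * (n + A + B + κ - 1) : MvPolynomial (Fin n ⊕ Fin n) ℂ) *
        (linForm Sum.inl c' ^ A * linForm Sum.inr c ^ B * normSqPoly n ^ (κ - 1)) := by
  have a1 : ∀ j, pderiv (Sum.inl j) (linForm Sum.inl c') = C (c' j) :=
    pderiv_linForm_self _ Sum.inl_injective c'
  have a2 : ∀ j, pderiv (Sum.inr j) (linForm Sum.inl c') = 0 := fun j =>
    pderiv_linForm_of_ne _ _ _ (by simp)
  have a3 : ∀ j, pderiv (Sum.inr j) (linForm Sum.inr c) = C (c j) :=
    pderiv_linForm_self _ Sum.inr_injective c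
  have a4 : ∀ j, pderiv (Sum.inl j) (linForm Sum.inr c) = 0 := fun j =>
    pderiv_linForm_of_ne _ _ _ (by simp)
  have hM : ∑ j, C (c j) * X (Sum.inr j) = linForm Sum.inr c := rfl
  have hL : ∑ j, C (c' j) * X (Sum.inl j) = linForm Sum.inl c' := rfl
  have hr : ∑ j, X (Sum.inl j) * X (Sum.inr j) = normSqPoly n := rfl
  set L := linForm Sum.inl c'
  set M := linForm Sum.inr c
  set r := normSqPoly n with r_def
  have b1 : ∀ j, pderiv (Sum.inl j) r = X (Sum.inr j) := pderiv_inl_normSqPoly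
  have b2 : ∀ j, pderiv (Sum.inr j) r = X (Sum.inl j) := pderiv_inr_normSqPoly
  have key : ∀ (j : Fin n) (a b d d' : MvPolynomial (Fin n ⊕ Fin n) ℂ),
      a = A → b = B → d = κ → d' = (κ - 1 : ℕ) →
      pderiv (Sum.inl j) (pderiv (Sum.inr j) (L ^ A * M ^ B * r ^ κ)) =
      (C (c' j) * C (c j)) * (a * b * (L ^ (A - 1) * M ^ (B - 1) * r ^ κ)) +
      (C (c j) * X (Sum.inr j)) * (b * d * (L ^ A * M ^ (B - 1) * r ^ (κ - 1))) +
      d * (L ^ A * M ^ B * r ^ (κ - 1)) +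
      (C (c' j) * X (Sum.inl j)) * (a * d * (L ^ (A - 1) * M ^ B * r ^ (κ - 1))) +
      (X (Sum.inl j) * X (Sum.inr j)) * (d * d' * (L ^ A * M ^ B * r ^ (κ - 1 - 1))) := by
    rintro j _ _ _ _ rfl rfl rfl rfl
    have h : pderiv (Sum.inr j) (L ^ A * M ^ B * r ^ κ) =
        C (c j) * ((B : ℂ) • (L ^ A * M ^ (B - 1) * r ^ κ)) +
        (κ : ℂ) • (X (Sum.inl j) * (L ^ A * M ^ B * r ^ (κ - 1))) := by
      simp only [pderiv_mul, pderiv_pow, a2, a3, b2, smul_eq_C_mul, map_natCast]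
      ring
    rw [h]
    simp only [map_add, pderiv_C, Derivation.map_natCast, pderiv_mul, pderiv_pow, a1, a4, b1,
      pderiv_X_self, smul_eq_C_mul, map_natCast]
    ring
  rw [complexLaplacian_apply, Finset.sum_congr rfl fun j _ => key j _ _ _ _ rfl rfl rfl rfl]
  simp only [Finset.sum_add_distrib, ← Finset.sum_mul, hM, hL, hr]
  rw [Finset.sum_const, Finset.card_univ, Fintype.card_fin, nsmul_eq_mul, map_sum]
  simp only [map_mul]
  have e1 := natCast_mul_pow_pred L A
  have e2 := natCast_mul_pow_pred M B
  have e3 : (κ : MvPolynomial (Fin n ⊕ Fin n) ℂ) * (((κ - 1 : ℕ) :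
      MvPolynomial (Fin n ⊕ Fin n) ℂ) * (r * r ^ (κ - 1 - 1))) = κ * ((κ - 1) * r ^ (κ - 1)) := by
    rw [natCast_mul_pow_pred r (κ - 1)]
    rcases κ with _ | κ
    · simp
    · simp
  linear_combination (κ * L ^ A * r ^ (κ - 1)) * e2 + (κ * M ^ B * r ^ (κ - 1)) * e1 +
    L ^ A * M ^ B * e3

/-- The zonal harmonic of bidegree `(p, q)` with pole `w`, as a polynomial. -/
def zonalMv (p q : ℕ) (w : EuclideanSpace ℂ (Fin n)) : MvPolynomial (Fin n ⊕ Fin n) ℂ :=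
  ∑ κ ∈ Finset.range (min p q + 1), ((zonalCoeff n p q κ : ℂ) * (∑ i, conj (w i) * w i) ^ κ) •
    (linForm Sum.inl (fun i => conj (w i)) ^ (p - κ) * linForm Sum.inr (fun i => w i) ^ (q - κ) *
      normSqPoly n ^ κ)

theorem isWeightedHomogeneous_linForm (e : Fin n → Fin n ⊕ Fin n) (c : Fin n → ℂ) (d : ℕ × ℕ)
    (h : ∀ i, bidegreeWeight n (e i) = d) :
    IsWeightedHomogeneous (bidegreeWeight n) (linForm e c) d :=
  IsWeightedHomogeneous.sum _ _ _ fun i _ => by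
    rw [← h i]
    simpa using (isWeightedHomogeneous_C (bidegreeWeight n) (c i)).mul
      (isWeightedHomogeneous_X ℂ (bidegreeWeight n) (e i))

theorem isWeightedHomogeneous_normSqPoly :
    IsWeightedHomogeneous (bidegreeWeight n) (normSqPoly n) (1, 1) :=
  IsWeightedHomogeneous.sum _ _ _ fun i _ => by
    simpa [bidegreeWeight] using (isWeightedHomogeneous_X ℂ (bidegreeWeight n) (Sum.inl i)).mul
      (isWeightedHomogeneous_X ℂ (bidegreeWeight n) (Sum.inr i))

theorem zonalMv_mem (hn : 1 ≤ n) (p q : ℕ) (w : EuclideanSpace ℂ (Fin n)) :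
    zonalMv p q w ∈ bihomHarmonic n p q := by
  rw [mem_bihomHarmonic]
  constructor
  · rw [← mem_weightedHomogeneousSubmodule]
    refine Submodule.sum_mem _ fun κ hκ => Submodule.smul_mem _ _ ?_
    have hκ := Finset.mem_range.1 hκ
    rw [mem_weightedHomogeneousSubmodule]
    convert (((isWeightedHomogeneous_linForm Sum.inl (fun i => conj (w i)) (1, 0)
      (by simp [bidegreeWeight])).pow (p - κ)).mul ((isWeightedHomogeneous_linForm Sum.inr
      (fun i => w i) (0, 1) (by simp [bidegreeWeight])).pow (q - κ))).mul
      ((isWeightedHomogeneous_normSqPoly (n := n)).pow κ) using 1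
    simp
    omega
  · let N : ℂ := ∑ i, conj (w i) * w i
    let L := linForm Sum.inl (fun i => conj (w i))
    let M := linForm Sum.inr (fun i => w i)
    let f : ℕ → MvPolynomial (Fin n ⊕ Fin n) ℂ := fun κ =>
      ((zonalCoeff n p q κ : ℂ) * N ^ (κ + 1) * ((p : ℂ) - κ) * (q - κ)) •
        (L ^ (p - κ - 1) * M ^ (q - κ - 1) * normSqPoly n ^ κ)
    let g : ℕ → MvPolynomial (Fin n ⊕ Fin n) ℂ := fun κ =>
      ((zonalCoeff n p q κ : ℂ) * N ^ κ * (κ * (n + (p - κ) + (q - κ) + κ - 1))) •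
        (L ^ (p - κ) * M ^ (q - κ) * normSqPoly n ^ (κ - 1))
    have h1 : complexLaplacian n (zonalMv p q w) =
        ∑ κ ∈ Finset.range (min p q + 1), f κ + ∑ κ ∈ Finset.range (min p q + 1), g κ := by
      rw [zonalMv, map_sum, ← Finset.sum_add_distrib]
      refine Finset.sum_congr rfl fun κ hκ => ?_
      have hκ := Finset.mem_range.1 hκ
      have hp : ((p - κ : ℕ) : ℂ) = (p : ℂ) - κ := Nat.cast_sub (by omega)
      have hq : ((q - κ : ℕ) : ℂ) = (q : ℂ) - κ := Nat.cast_sub (by omega)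
      rw [map_smul, complexLaplacian_linForm_pow_mul]
      simp only [f, g, smul_eq_C_mul, ← map_natCast (C (σ := Fin n ⊕ Fin n) (R := ℂ)),
        ← hp, ← hq]
      simp only [map_mul, map_add, map_sub, map_pow, map_one, N, L, M]
      ring
    -- The Laplacian of each summand has one part with the same power of |z|² and one with the next
    -- lower power; the zonal coefficients are chosen so that neighbours cancel.
    have h2 : ∀ κ, g (κ + 1) = -f κ := by
      intro κ
      have h := congrArg (fun x : ℝ => (x : ℂ)) (zonalCoeff_succ n p q κ hn)
      push_cast at h
      simp only [f, g]
      rw [← neg_smul, Nat.add_sub_cancel, show p - (κ + 1) = p - κ - 1 by omega,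
        show q - (κ + 1) = q - κ - 1 by omega]
      congr 1
      push_cast
      linear_combination N ^ (κ + 1) * h
    have h3 : f (min p q) = 0 := by
      simp only [f]
      rcases le_total p q with h | h <;> simp [h]
    have h4 : g 0 = 0 := by simp [g]
    rw [h1, Finset.sum_range_succ, Finset.sum_range_succ' g, h3, h4, add_zero, add_zero,
      Finset.sum_congr rfl fun κ _ => h2 κ, Finset.sum_neg_distrib, add_neg_cancel]

theorem evalConj_linForm_inl (w z : EuclideanSpace ℂ (Fin n)) :
    evalConj (linForm Sum.inl (fun i => conj (w i))) z = hermProd z w := by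
  simp [evalConj, linForm, hermProd, mul_comm]

theorem evalConj_linForm_inr (w z : EuclideanSpace ℂ (Fin n)) :
    evalConj (linForm Sum.inr (fun i => w i)) z = hermProd w z := by
  simp [evalConj, linForm, hermProd]

theorem sum_conj_mul_self (w : EuclideanSpace ℂ (Fin n)) :
    ∑ i, conj (w i) * w i = (‖w‖ : ℂ) ^ 2 := by
  rw [← Complex.ofReal_pow, EuclideanSpace.norm_sq_eq]
  push_cast
  exact Finset.sum_congr rfl fun i _ => Complex.conj_mul' (w i)

theorem evalConj_normSqPoly (z : EuclideanSpace ℂ (Fin n)) :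
    evalConj (normSqPoly n) z = (‖z‖ : ℂ) ^ 2 := by
  rw [← sum_conj_mul_self]
  simp [evalConj, normSqPoly, mul_comm]

theorem evalConj_zonalMv (p q : ℕ) (z w : EuclideanSpace ℂ (Fin n)) :
    evalConj (zonalMv p q w) z =
      zonalPoly n p q (hermProd z w) (hermProd w z) (((‖z‖ ^ 2 : ℝ) : ℂ) * ((‖w‖ ^ 2 : ℝ) : ℂ)) := by
  have h1 := evalConj_linForm_inl w z
  have h2 := evalConj_linForm_inr w z
  have h3 := evalConj_normSqPoly z
  rw [evalConj] at h1 h2 h3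
  rw [evalConj, zonalMv, zonalPoly, map_sum]
  refine Finset.sum_congr rfl fun κ _ => ?_
  rw [smul_eval, map_mul, map_mul, map_pow, map_pow, map_pow, h1, h2, h3, sum_conj_mul_self]
  push_cast
  ring

theorem conj_hermProd (z w : EuclideanSpace ℂ (Fin n)) : conj (hermProd z w) = hermProd w z := by
  simp [hermProd, mul_comm]

end MvPolynomial

/-! ### From Gaussian integrals to integrals over the sphere -/

section

open MeasureTheory

theorem integral_pow_mul_conj_pow_mul_exp (a b : ℕ) :
    ∫ z : ℂ, z ^ a * conj z ^ b * (Real.exp (-‖z‖ ^ 2) : ℂ) =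
      if a = b then (Real.pi * a.factorial : ℂ) else 0 := by
  split_ifs with h
  · subst h
    have h1 := Complex.integral_rpow_mul_exp_neg_rpow (p := 2) (q := 2 * a) (by norm_num)
      (by have : (0 : ℝ) ≤ a := by positivity
          linarith)
    have h2 : ∀ z : ℂ, z ^ a * conj z ^ a * (Real.exp (-‖z‖ ^ 2) : ℂ) =
        ((‖z‖ ^ (2 * a : ℝ) * Real.exp (-‖z‖ ^ (2 : ℝ)) : ℝ) : ℂ) := by
      intro z
      rw [← mul_pow, Complex.mul_conj', Real.rpow_mul (norm_nonneg _), Real.rpow_natCast,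
        Real.rpow_two]
      push_cast
      ring
    simp_rw [h2]
    rw [integral_complex_ofReal, h1, show ((2 * a + 2) / 2 : ℝ) = a + 1 by ring,
      Real.Gamma_nat_eq_factorial]
    push_cast
    ring
  -- A rotation with θ^(a-b) = -1 changes the sign of the integrand and preserves the measure, so
  -- the integral vanishes.
  · let θ : ℂ := Complex.exp (Real.pi * Complex.I / ((a : ℂ) - b))
    have hab : (a : ℂ) - b ≠ 0 := sub_ne_zero.2 (by exact_mod_cast h)
    have hθ : θ = Complex.exp (((Real.pi / ((a : ℝ) - b) : ℝ) : ℂ) * Complex.I) := by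
      simp only [θ]
      push_cast
      ring_nf
    have hn : ‖θ‖ = 1 := by rw [hθ, Complex.norm_exp_ofReal_mul_I]
    have hθ0 : θ ≠ 0 := Complex.exp_ne_zero _
    have hc : conj θ = θ⁻¹ := by rw [Complex.inv_def, Complex.normSq_eq_norm_sq, hn]; simp
    have hp : θ ^ a * conj θ ^ b = -1 := by
      rw [hc, ← Complex.exp_neg, ← Complex.exp_nat_mul, ← Complex.exp_nat_mul, ← Complex.exp_add,
        ← Complex.exp_pi_mul_I]
      congr 1
      field_simp
      ring
    let R : Circle := ⟨θ, by simp [Submonoid.unitSphere, hn]⟩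
    have h1 := ((rotation R).measurePreserving).integral_comp
      (rotation R).toHomeomorph.measurableEmbedding
      (fun z : ℂ => z ^ a * conj z ^ b * (Real.exp (-‖z‖ ^ 2) : ℂ))
    have h2 : ∀ z : ℂ, (fun z : ℂ => z ^ a * conj z ^ b * (Real.exp (-‖z‖ ^ 2) : ℂ))
        (rotation R z) = - (z ^ a * conj z ^ b * (Real.exp (-‖z‖ ^ 2) : ℂ)) := by
      intro z
      have : rotation R z = θ * z := rfl
      simp only [this, mul_pow, map_mul, norm_mul, hn, one_mul]
      linear_combination z ^ a * conj z ^ b * (Real.exp (-‖z‖ ^ 2) : ℂ) * hp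
    simp_rw [h2] at h1
    rw [integral_neg] at h1
    exact self_eq_neg.1 h1.symm

theorem finrank_real_euclideanSpace_complex (n : ℕ) :
    Module.finrank ℝ (EuclideanSpace ℂ (Fin n)) = 2 * n := by
  rw [(WithLp.linearEquiv 2 ℝ (Fin n → ℂ)).finrank_eq, Module.finrank_pi_fintype]
  simp [mul_comm]

theorem exp_neg_norm_sq_eq_prod {n : ℕ} (x : EuclideanSpace ℂ (Fin n)) :
    Real.exp (-‖x‖ ^ 2) = ∏ i, Real.exp (-‖x i‖ ^ 2) := by
  rw [← Real.exp_sum, EuclideanSpace.norm_sq_eq, Finset.sum_neg_distrib]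

/-- Both are Haar measures, hence proportional; the Gaussian integral π^n of each fixes the factor
as 1. -/
theorem volume_euclideanSpace_complex_eq_map (n : ℕ) :
    (volume : Measure (EuclideanSpace ℂ (Fin n))) =
      (volume : Measure (Fin n → ℂ)).map (WithLp.toLp 2) := by
  set μ := (volume : Measure (Fin n → ℂ)).map (WithLp.toLp 2 : _ → EuclideanSpace ℂ (Fin n))
    with hμ
  have : μ.IsAddHaarMeasure :=
    (PiLp.continuousLinearEquiv 2 ℝ (fun _ : Fin n => ℂ)).symm.isAddHaarMeasure_map _
  have h := Measure.isAddLeftInvariant_eq_smul μ (volume : Measure (EuclideanSpace ℂ (Fin n)))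
  set c := Measure.addHaarScalarFactor μ (volume : Measure (EuclideanSpace ℂ (Fin n)))
  have h1 : ∫ x, Real.exp (-‖x‖ ^ 2) ∂μ = Real.pi ^ n := by
    have e := (MeasurableEquiv.toLp 2 (Fin n → ℂ)).measurableEmbedding.integral_map
      (μ := volume) (fun x : EuclideanSpace ℂ (Fin n) => Real.exp (-‖x‖ ^ 2))
    have e1 := integral_pow_mul_conj_pow_mul_exp 0 0
    simp only [pow_zero, mul_one, one_mul, if_true, Nat.factorial_zero, Nat.cast_one] at e1
    rw [integral_complex_ofReal] at e1
    have e2 : ∫ z : ℂ, Real.exp (-‖z‖ ^ 2) = Real.pi := by exact_mod_cast e1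
    rw [hμ]
    refine e.trans ?_
    simp only [MeasurableEquiv.coe_toLp, exp_neg_norm_sq_eq_prod]
    rw [integral_fintype_prod_volume_eq_pow (fun z : ℂ => Real.exp (-‖z‖ ^ 2)), e2,
      Fintype.card_fin]
  have h2 : ∫ x : EuclideanSpace ℂ (Fin n), Real.exp (-‖x‖ ^ 2) = Real.pi ^ n := by
    have e := GaussianFourier.integral_rexp_neg_mul_sq_norm (V := EuclideanSpace ℂ (Fin n))
      (b := 1) one_pos
    have e' : (Module.finrank ℝ (EuclideanSpace ℂ (Fin n)) : ℝ) / 2 = n := by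
      have := finrank_real_euclideanSpace_complex n
      rw [show (Module.finrank ℝ (EuclideanSpace ℂ (Fin n)) : ℝ) = ((2 * n : ℕ) : ℝ) from
        congrArg _ this]
      push_cast
      ring
    rw [e', div_one, Real.rpow_natCast] at e
    simpa using e
  have h3 : (c : ℝ) * Real.pi ^ n = Real.pi ^ n := by
    have e := integral_smul_nnreal_measure (μ := volume)
      (fun x : EuclideanSpace ℂ (Fin n) => Real.exp (-‖x‖ ^ 2)) c
    rw [← h, h1, h2, NNReal.smul_def, smul_eq_mul] at e
    exact e.symm
  have h4 : c = 1 := by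
    have : Real.pi ^ n ≠ 0 := by positivity
    exact_mod_cast (mul_eq_right₀ this).1 h3
  rw [h, h4, one_smul]

/-- Integration in polar coordinates of a function that is a product of a function on the sphere
and a function of the radius. -/
theorem integral_eq_integral_toSphere_mul {E : Type*} [NormedAddCommGroup E] [NormedSpace ℝ E]
    [MeasurableSpace E] [BorelSpace E] [FiniteDimensional ℝ E] [Nontrivial E] (μ : Measure E)
    [μ.IsAddHaarMeasure] (f : E → ℂ) (g : Metric.sphere (0 : E) 1 → ℂ) (φ : ℝ → ℂ)
    (h : ∀ (x : Metric.sphere (0 : E) 1) (r : ℝ), 0 < r → f (r • (x : E)) = g x * φ r) :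
    ∫ x, f x ∂μ = (∫ x, g x ∂μ.toSphere) *
      ∫ r in Set.Ioi (0 : ℝ), ((r ^ (Module.finrank ℝ E - 1) : ℝ) : ℂ) * φ r := by
  calc
    ∫ x, f x ∂μ = ∫ x : ({(0)}ᶜ : Set E), f x.1 ∂(μ.comap (↑)) := by
      rw [integral_subtype_comap (measurableSet_singleton _).compl f, restrict_compl_singleton]
    _ = ∫ x, g x.1 * φ x.2 ∂μ.toSphere.prod (.volumeIoiPow (Module.finrank ℝ E - 1)) := by
      rw [← μ.measurePreserving_homeomorphUnitSphereProd.integral_comp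
        (Homeomorph.measurableEmbedding _) (fun x : Metric.sphere (0 : E) 1 × Set.Ioi (0 : ℝ) =>
          g x.1 * φ x.2)]
      refine integral_congr_ae (Filter.Eventually.of_forall fun x => ?_)
      simp only
      rw [← h _ _ (homeomorphUnitSphereProd E x).2.2]
      have hx : ‖(x : E)‖ ≠ 0 := norm_ne_zero_iff.2 x.2
      simp [smul_smul, hx]
    _ = (∫ x, g x ∂μ.toSphere) *
        ∫ r : Set.Ioi (0 : ℝ), φ r ∂(.volumeIoiPow (Module.finrank ℝ E - 1)) :=
      integral_prod_mul g fun r : Set.Ioi (0 : ℝ) => φ r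
    _ = _ := by
      congr 1
      simp only [Measure.volumeIoiPow, ENNReal.ofReal]
      rw [integral_withDensity_eq_integral_smul,
        integral_subtype_comap measurableSet_Ioi fun a =>
          Real.toNNReal (a ^ (Module.finrank ℝ E - 1)) • φ a,
        setIntegral_congr_fun measurableSet_Ioi fun x hx => ?_]
      · rw [NNReal.smul_def, Real.coe_toNNReal _ (pow_nonneg (le_of_lt hx) _), Complex.real_smul]
      · exact (measurable_subtype_coe.pow_const _).real_toNNReal

theorem evalConj_monomial {n : ℕ} (d : Fin n ⊕ Fin n →₀ ℕ) (c : ℂ)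
    (x : EuclideanSpace ℂ (Fin n)) : evalConj (MvPolynomial.monomial d c) x =
      c * ∏ i, (x i ^ d (Sum.inl i) * conj (x i) ^ d (Sum.inr i)) := by
  rw [evalConj, MvPolynomial.eval_monomial, Finsupp.prod_fintype _ _ (by simp),
    Fintype.prod_sum_type, Finset.prod_mul_distrib]
  simp

theorem integral_evalConj_monomial_mul_exp {n : ℕ} (d : Fin n ⊕ Fin n →₀ ℕ) (c : ℂ) :
    ∫ x : EuclideanSpace ℂ (Fin n),
      evalConj (MvPolynomial.monomial d c) x * (Real.exp (-‖x‖ ^ 2) : ℂ) =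
    Real.pi ^ n * gaussMoment n (MvPolynomial.monomial d c) := by
  have e := (MeasurableEquiv.toLp 2 (Fin n → ℂ)).measurableEmbedding.integral_map
    (μ := volume) (fun x : EuclideanSpace ℂ (Fin n) =>
      evalConj (MvPolynomial.monomial d c) x * (Real.exp (-‖x‖ ^ 2) : ℂ))
  rw [volume_euclideanSpace_complex_eq_map]
  refine e.trans ?_
  simp only [MeasurableEquiv.coe_toLp, exp_neg_norm_sq_eq_prod, evalConj_monomial,
    Complex.ofReal_prod, mul_assoc, ← Finset.prod_mul_distrib]
  rw [integral_const_mul, integral_fintype_prod_volume_eq_prod (fun i (z : ℂ) =>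
    z ^ d (Sum.inl i) * (conj z ^ d (Sum.inr i) * (Real.exp (-‖z‖ ^ 2) : ℂ)))]
  simp only [← mul_assoc, integral_pow_mul_conj_pow_mul_exp]
  have h : (Real.pi : ℂ) ^ n = ∏ _i : Fin n, (Real.pi : ℂ) := by simp
  rw [MvPolynomial.gaussMoment_monomial, mul_left_comm, h, ← Finset.prod_mul_distrib]
  congr 1
  exact Finset.prod_congr rfl fun i _ => by split_ifs <;> simp

theorem evalConj_monomial_smul {n N : ℕ} (d : Fin n ⊕ Fin n →₀ ℕ) (c : ℂ)
    (hd : Finsupp.weight (bidegreeWeight n) d = (N, N)) (r : ℝ) (x : EuclideanSpace ℂ (Fin n)) :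
    evalConj (MvPolynomial.monomial d c) (r • x) =
      evalConj (MvPolynomial.monomial d c) x * ((r ^ (2 * N) : ℝ) : ℂ) := by
  have h : (∑ i, d (Sum.inl i)) = N ∧ (∑ i, d (Sum.inr i)) = N := by
    rw [Finsupp.weight_eq_sum, Prod.ext_iff] at hd
    simpa [bidegreeWeight, Prod.fst_sum, Prod.snd_sum] using hd
  simp only [evalConj_monomial, PiLp.smul_apply, Complex.real_smul, map_mul, Complex.conj_ofReal,
    mul_pow]
  rw [show ∏ i, ((r : ℂ) ^ d (Sum.inl i) * x i ^ d (Sum.inl i) *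
      ((r : ℂ) ^ d (Sum.inr i) * conj (x i) ^ d (Sum.inr i))) =
      (∏ i, (r : ℂ) ^ d (Sum.inl i)) * (∏ i, (r : ℂ) ^ d (Sum.inr i)) *
      ∏ i, (x i ^ d (Sum.inl i) * conj (x i) ^ d (Sum.inr i)) by
    simp only [← Finset.prod_mul_distrib]
    exact Finset.prod_congr rfl fun i _ => by ring,
    Finset.prod_pow_eq_pow_sum, Finset.prod_pow_eq_pow_sum, h.1, h.2]
  push_cast
  ring

theorem integral_pow_mul_pow_mul_exp_neg_sq {n : ℕ} (hn : 1 ≤ n) (N : ℕ) :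
    ∫ r in Set.Ioi (0 : ℝ), r ^ (2 * n - 1) * (r ^ (2 * N) * Real.exp (-r ^ 2)) =
      (n - 1 + N).factorial / 2 := by
  have h := integral_rpow_mul_exp_neg_rpow (p := 2) (q := ((2 * n - 1 + 2 * N : ℕ) : ℝ))
    (by norm_num) (lt_of_lt_of_le (by norm_num) (Nat.cast_nonneg _))
  have e : (((2 * n - 1 + 2 * N : ℕ) : ℝ) + 1) / 2 = ((n - 1 + N : ℕ) : ℝ) + 1 := by
    rw [div_eq_iff two_ne_zero]
    exact_mod_cast (by omega : 2 * n - 1 + 2 * N + 1 = (n - 1 + N + 1) * 2)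
  rw [e, Real.Gamma_nat_eq_factorial] at h
  simp only [Real.rpow_natCast, Real.rpow_two, pow_add _ (2 * n - 1), mul_assoc] at h
  rw [h]
  ring

theorem continuous_evalConj {n : ℕ} (P : MvPolynomial (Fin n ⊕ Fin n) ℂ) :
    Continuous (evalConj P) := by
  unfold evalConj
  simp only [MvPolynomial.eval_eq]
  refine continuous_finsetSum _ fun d _ => continuous_const.mul <|
    continuous_finsetProd _ fun i _ => Continuous.pow ?_ _
  rcases i with i | i
  · exact (EuclideanSpace.proj (𝕜 := ℂ) i).continuous
  · exact Complex.continuous_conj.comp (EuclideanSpace.proj (𝕜 := ℂ) i).continuous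

theorem integrable_evalConj_sphere {n : ℕ} (P : MvPolynomial (Fin n ⊕ Fin n) ℂ) :
    Integrable (fun x : Metric.sphere (0 : EuclideanSpace ℂ (Fin n)) 1 => evalConj P x)
      (volume : Measure (EuclideanSpace ℂ (Fin n))).toSphere :=
  ((continuous_evalConj P).comp continuous_subtype_val).integrable_of_hasCompactSupport
    (HasCompactSupport.of_compactSpace _)

/-- In polar coordinates the Gaussian integral of a monomial of bidegree (N,N) is its sphere
integral times a radial integral equal to (n-1+N)!/2. -/
theorem integral_sphere_evalConj {n N : ℕ} (hn : 1 ≤ n) (P : MvPolynomial (Fin n ⊕ Fin n) ℂ)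
    (hP : MvPolynomial.IsWeightedHomogeneous (bidegreeWeight n) P (N, N)) :
    ∫ x : Metric.sphere (0 : EuclideanSpace ℂ (Fin n)) 1, evalConj P x
      ∂((volume : Measure (EuclideanSpace ℂ (Fin n))).toSphere) =
    2 * Real.pi ^ n / (n - 1 + N).factorial * gaussMoment n P := by
  have : Nonempty (Fin n) := ⟨⟨0, hn⟩⟩
  have hmono : ∀ d ∈ P.support, ∫ x : Metric.sphere (0 : EuclideanSpace ℂ (Fin n)) 1,
      evalConj (MvPolynomial.monomial d (P.coeff d)) x
      ∂((volume : Measure (EuclideanSpace ℂ (Fin n))).toSphere) =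
      2 * Real.pi ^ n / (n - 1 + N).factorial *
        gaussMoment n (MvPolynomial.monomial d (P.coeff d)) := by
    intro d hd
    have hd := hP (MvPolynomial.mem_support_iff.1 hd)
    have h := integral_eq_integral_toSphere_mul (volume : Measure (EuclideanSpace ℂ (Fin n)))
      (fun x => evalConj (MvPolynomial.monomial d (P.coeff d)) x * (Real.exp (-‖x‖ ^ 2) : ℂ))
      (fun x => evalConj (MvPolynomial.monomial d (P.coeff d)) x)
      (fun r => ((r ^ (2 * N) * Real.exp (-r ^ 2) : ℝ) : ℂ)) (by
        intro x r hr
        have hx : ‖(x : EuclideanSpace ℂ (Fin n))‖ = 1 := by simp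
        rw [evalConj_monomial_smul d _ hd, norm_smul, hx, Real.norm_of_nonneg hr.le, mul_one]
        push_cast
        ring)
    rw [integral_evalConj_monomial_mul_exp] at h
    simp only [← Complex.ofReal_mul] at h
    have hf : Module.finrank ℝ (EuclideanSpace ℂ (Fin n)) = 2 * n :=
      finrank_real_euclideanSpace_complex n
    rw [hf, integral_complex_ofReal, integral_pow_mul_pow_mul_exp_neg_sq hn] at h
    push_cast at h
    have h0 : ((n - 1 + N).factorial : ℂ) ≠ 0 := by exact_mod_cast Nat.factorial_ne_zero _
    field_simp
    linear_combination -2 * h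
  have hs : ∀ x, evalConj P x =
      ∑ d ∈ P.support, evalConj (MvPolynomial.monomial d (P.coeff d)) x := by
    intro x
    conv_lhs => rw [P.as_sum]
    simp only [evalConj, map_sum]
  simp only [hs]
  rw [integral_finsetSum _ fun d _ => integrable_evalConj_sphere _,
    Finset.sum_congr rfl hmono, ← Finset.mul_sum, ← map_sum, ← P.as_sum]

end

/-! ### Reproducing kernels of spherical harmonics -/

section

open MeasureTheory MvPolynomial

theorem evalConj_mul {n : ℕ} (P Q : MvPolynomial (Fin n ⊕ Fin n) ℂ)
    (x : EuclideanSpace ℂ (Fin n)) : evalConj (P * Q) x = evalConj P x * evalConj Q x :=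
  map_mul _ _ _

theorem evalConj_pow {n : ℕ} (P : MvPolynomial (Fin n ⊕ Fin n) ℂ) (N : ℕ)
    (x : EuclideanSpace ℂ (Fin n)) : evalConj (P ^ N) x = evalConj P x ^ N :=
  map_pow _ _ _

theorem conj_evalConj_zonalMv {n : ℕ} (p q : ℕ) (w x : EuclideanSpace ℂ (Fin n)) (hx : ‖x‖ = 1) :
    conj (evalConj (zonalMv p q w) x) = ∑ κ ∈ Finset.range (min p q + 1),
      (zonalCoeff n p q κ * ((‖w‖ ^ 2 : ℝ) : ℂ) ^ κ) *
        (hermProd w x ^ (p - κ) * hermProd x w ^ (q - κ)) := by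
  rw [evalConj_zonalMv, zonalPoly, map_sum]
  refine Finset.sum_congr rfl fun κ _ => ?_
  simp only [map_mul, map_pow, conj_hermProd, Complex.conj_ofReal, hx]
  push_cast
  ring

/-- On the sphere |z|² = 1, so each zonal summand with κ > 0 pairs P with too few linear factors and
integrates to zero; only the leading term contributes. -/
theorem sphereInner_zonalMv {n : ℕ} (hn : 1 ≤ n) (p q : ℕ) (w : EuclideanSpace ℂ (Fin n))
    {P : MvPolynomial (Fin n ⊕ Fin n) ℂ} (hP : P ∈ bihomHarmonic n p q) :
    sphereInner P (zonalMv p q w) =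
      2 * Real.pi ^ n / (n - 1 + (p + q)).factorial * (p.factorial * q.factorial) *
        evalConj P w := by
  let Q : ℕ → MvPolynomial (Fin n ⊕ Fin n) ℂ := fun κ =>
    P * linForm Sum.inr (fun i => w i) ^ (p - κ) * linForm Sum.inl (fun i => conj (w i)) ^ (q - κ)
  have h1 : ∀ x : Metric.sphere (0 : EuclideanSpace ℂ (Fin n)) 1,
      evalConj P x * conj (evalConj (zonalMv p q w) x) = ∑ κ ∈ Finset.range (min p q + 1),
        (zonalCoeff n p q κ * ((‖w‖ ^ 2 : ℝ) : ℂ) ^ κ) * evalConj (Q κ) x := by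
    intro x
    rw [conj_evalConj_zonalMv p q w x (by simp), Finset.mul_sum]
    refine Finset.sum_congr rfl fun κ _ => ?_
    simp only [Q, evalConj_mul, evalConj_pow, evalConj_linForm_inl, evalConj_linForm_inr]
    ring
  have h2 : ∀ κ ∈ Finset.range (min p q + 1),
      ∫ x : Metric.sphere (0 : EuclideanSpace ℂ (Fin n)) 1,
        (zonalCoeff n p q κ * ((‖w‖ ^ 2 : ℝ) : ℂ) ^ κ) * evalConj (Q κ) x
        ∂((volume : Measure (EuclideanSpace ℂ (Fin n))).toSphere) =
      if κ = 0 then 2 * Real.pi ^ n / (n - 1 + (p + q)).factorial *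
        (p.factorial * q.factorial) * evalConj P w else 0 := by
    intro κ hκ
    have hκ := Finset.mem_range.1 hκ
    have hQ : IsWeightedHomogeneous (bidegreeWeight n) (Q κ) (p + q - κ, p + q - κ) := by
      convert ((mem_bihomHarmonic.1 hP).1.mul ((isWeightedHomogeneous_linForm Sum.inr
        (fun i => w i) (0, 1) (by simp [bidegreeWeight])).pow (p - κ))).mul
        ((isWeightedHomogeneous_linForm Sum.inl (fun i => conj (w i)) (1, 0)
          (by simp [bidegreeWeight])).pow (q - κ)) using 1
      simp
      omega
    rw [integral_const_mul, integral_sphere_evalConj hn _ hQ,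
      gaussMoment_mul_linForm_pow w (q - κ) (p - κ) p q P hP (by omega) (by omega)]
    by_cases h0 : κ = 0
    · subst h0
      simp [zonalCoeff]
      ring
    · rw [if_neg (by omega), if_neg h0, mul_zero, mul_zero]
  rw [sphereInner]
  simp only [h1]
  rw [integral_finsetSum _ fun κ _ => (integrable_evalConj_sphere (Q κ)).const_mul _,
    Finset.sum_congr rfl h2]
  simp

theorem sphereInner_sum_smul {n : ℕ} {ι : Type*} [Fintype ι] (P : MvPolynomial (Fin n ⊕ Fin n) ℂ)
    (c : ι → ℂ) (Q : ι → MvPolynomial (Fin n ⊕ Fin n) ℂ) :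
    sphereInner P (∑ i, c i • Q i) = ∑ i, conj (c i) * sphereInner P (Q i) := by
  have h : ∀ x : EuclideanSpace ℂ (Fin n), evalConj P x * conj (evalConj (∑ i, c i • Q i) x) =
      ∑ i, conj (c i) * (evalConj P x * conj (evalConj (Q i) x)) := by
    intro x
    simp only [evalConj, map_sum, smul_eval, map_mul, Finset.mul_sum]
    exact Finset.sum_congr rfl fun i _ => by ring
  simp only [sphereInner, h]
  rw [integral_finsetSum]
  · simp only [integral_const_mul]
  · intro i _
    refine Integrable.const_mul ?_ _
    exact (((continuous_evalConj P).mul (Complex.continuous_conj.comp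
      (continuous_evalConj (Q i)))).comp continuous_subtype_val).integrable_of_hasCompactSupport
      (HasCompactSupport.of_compactSpace _)

/-- The reproducing kernel of the space of spherical harmonics of bidegree `(p, q)`. -/
theorem sum_orthonormal_basis_eq_zonalPoly {n p q : ℕ} (hn : 1 ≤ n)
    (h : Module.Basis (Fin (harmonicDim n p q)) ℂ (bihomHarmonic n p q))
    (hh : IsSphereOrthonormal h) (z w : EuclideanSpace ℂ (Fin n)) :
    ∑ j, evalConj (h j : MvPolynomial (Fin n ⊕ Fin n) ℂ) z *
      conj (evalConj (h j : MvPolynomial (Fin n ⊕ Fin n) ℂ) w) =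
    (((n - 1 + (p + q)).factorial / (2 * Real.pi ^ n * (p.factorial * q.factorial)) : ℝ) : ℂ) *
      zonalPoly n p q (hermProd z w) (hermProd w z)
        (((‖z‖ ^ 2 : ℝ) : ℂ) * ((‖w‖ ^ 2 : ℝ) : ℂ)) := by
  -- The zonal harmonic is expanded in the basis; by the reproducing property its coefficients are
  -- multiples of conj(h_j(w)).
  let R : bihomHarmonic n p q := ⟨zonalMv p q w, zonalMv_mem hn p q w⟩
  have hR : zonalMv p q w = ∑ j, h.repr R j • (h j : MvPolynomial (Fin n ⊕ Fin n) ℂ) := by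
    have e := congrArg (Submodule.subtype _) (h.sum_repr R)
    simp only [map_sum, map_smul, Submodule.subtype_apply] at e
    exact e.symm
  have hc : ∀ j, conj (h.repr R j) = 2 * Real.pi ^ n / (n - 1 + (p + q)).factorial *
      (p.factorial * q.factorial) * evalConj (h j : MvPolynomial (Fin n ⊕ Fin n) ℂ) w := by
    intro j
    rw [← sphereInner_zonalMv hn p q w (h j).2, hR, sphereInner_sum_smul]
    simp [hh j]
  have hc' : ∀ j, h.repr R j = 2 * Real.pi ^ n / (n - 1 + (p + q)).factorial *
      (p.factorial * q.factorial) *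
        conj (evalConj (h j : MvPolynomial (Fin n ⊕ Fin n) ℂ) w) := by
    intro j
    have e := congrArg conj (hc j)
    simpa [map_ofNat] using e
  have hz : evalConj (zonalMv p q w) z =
      ∑ j, h.repr R j * evalConj (h j : MvPolynomial (Fin n ⊕ Fin n) ℂ) z := by
    conv_lhs => rw [hR]
    simp only [evalConj, map_sum, smul_eval]
  rw [← evalConj_zonalMv, hz, Finset.mul_sum]
  refine Finset.sum_congr rfl fun j _ => ?_
  rw [hc' j]
  have h0 : ((n - 1 + (p + q)).factorial : ℂ) ≠ 0 := by exact_mod_cast Nat.factorial_ne_zero _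
  have h1 : (p.factorial : ℂ) ≠ 0 := by exact_mod_cast Nat.factorial_ne_zero _
  have h2 : (q.factorial : ℂ) ≠ 0 := by exact_mod_cast Nat.factorial_ne_zero _
  have h3 : (Real.pi : ℂ) ≠ 0 := by exact_mod_cast Real.pi_ne_zero
  push_cast
  field_simp

/-! ### Normalizing constants and the Fubini–Study distance -/

theorem normConst_sq_mul (n m k p q : ℕ) (ν : ℝ) (hν : 2 * ν = k) (hp : p ≤ m) (hq : q ≤ m + k) :
    normConst (n + 1) ν m p q ^ 2 *
      ((n + (p + q)).factorial / (2 * Real.pi ^ (n + 1) * (p.factorial * q.factorial))) =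
    (2 * m + 2 * ν + (n + 1 : ℕ)) * Real.Gamma (m + 2 * ν + (n + 1 : ℕ)) /
      (Real.pi ^ (n + 1) * Real.Gamma (m + 2 * ν + 1)) * kernelBase (n + 1) m k p q := by
  have g1 : Real.Gamma (m + q + (n + 1 : ℕ)) = (m + q + n).factorial := by
    rw [← Real.Gamma_nat_eq_factorial]; push_cast; ring_nf
  have g2 : Real.Gamma (m + k + p + (n + 1 : ℕ)) = (m + k + p + n).factorial := by
    rw [← Real.Gamma_nat_eq_factorial]; push_cast; ring_nf
  have g3 : Real.Gamma ((n + 1 : ℕ) + p + q) = (n + p + q).factorial := by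
    rw [← Real.Gamma_nat_eq_factorial]; push_cast; ring_nf
  have g4 : Real.Gamma ((m : ℝ) - p + 1) = (m - p).factorial := by
    rw [← Real.Gamma_nat_eq_factorial, Nat.cast_sub hp]
  have g5 : Real.Gamma ((m : ℝ) + k - q + 1) = (m + k - q).factorial := by
    rw [← Real.Gamma_nat_eq_factorial, Nat.cast_sub hq]; push_cast; rfl
  have g6 : Real.Gamma (m + k + (n + 1 : ℕ)) = (m + k + n).factorial := by
    rw [← Real.Gamma_nat_eq_factorial]; push_cast; ring_nf
  have g7 : Real.Gamma ((m : ℝ) + k + 1) = (m + k).factorial := by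
    rw [← Real.Gamma_nat_eq_factorial]; push_cast; rfl
  have hb := kernelBase_eq n m k p q hp hq
  rw [normConst, Real.sq_sqrt]
  · rw [hν, g1, g2, g3, g4, g5, g6, g7, show n + (p + q) = n + p + q by ring]
    have f1 : ((n + p + q).factorial : ℝ) ≠ 0 := by positivity
    have f2 : ((m - p).factorial : ℝ) ≠ 0 := by positivity
    have f3 : ((m + k - q).factorial : ℝ) ≠ 0 := by positivity
    have f4 : (p.factorial : ℝ) ≠ 0 := by positivity
    have f5 : (q.factorial : ℝ) ≠ 0 := by positivity
    have f6 : ((m + k).factorial : ℝ) ≠ 0 := by positivity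
    have f7 : Real.pi ≠ 0 := Real.pi_ne_zero
    generalize ((n + p + q).factorial : ℝ) = F1 at *
    generalize ((m - p).factorial : ℝ) = F2 at *
    generalize ((m + k - q).factorial : ℝ) = F3 at *
    generalize (p.factorial : ℝ) = F4 at *
    generalize (q.factorial : ℝ) = F5 at *
    generalize ((m + k).factorial : ℝ) = F6 at *
    rw [div_mul_div_comm, div_mul_eq_mul_div, div_eq_div_iff (by positivity) (by positivity)]
    linear_combination (-2 * (2 * (m : ℝ) + k + (n + 1 : ℕ)) * F1 * Real.pi ^ (n + 1)) * hb
  · rw [hν, g1, g2, g3, g4, g5]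
    positivity

theorem hermProd_eq_inner {n : ℕ} (z w : EuclideanSpace ℂ (Fin n)) :
    hermProd z w = inner ℂ w z := by
  simp [hermProd, PiLp.inner_apply]

theorem norm_one_add_hermProd_le {n : ℕ} (z w : EuclideanSpace ℂ (Fin n)) :
    ‖1 + hermProd z w‖ ^ 2 ≤ (1 + ‖z‖ ^ 2) * (1 + ‖w‖ ^ 2) := by
  have h1 : ‖hermProd z w‖ ≤ ‖w‖ * ‖z‖ := by
    rw [hermProd_eq_inner]
    exact norm_inner_le_norm w z
  have h2 : ‖1 + hermProd z w‖ ≤ 1 + ‖w‖ * ‖z‖ := by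
    refine (norm_add_le _ _).trans ?_
    rw [norm_one]
    linarith
  calc ‖1 + hermProd z w‖ ^ 2 ≤ (1 + ‖w‖ * ‖z‖) ^ 2 := by gcongr
    _ ≤ _ := by nlinarith [sq_nonneg (‖z‖ - ‖w‖)]

/-- Cauchy–Schwarz puts the argument of `arccos` in [-1, 1], so the double-angle formula applies
without clamping. -/
theorem cos_two_mul_fubiniStudyDist {n : ℕ} (z w : EuclideanSpace ℂ (Fin n)) :
    Real.cos (2 * fubiniStudyDist z w) =
      2 * ‖1 + hermProd z w‖ ^ 2 / ((1 + ‖z‖ ^ 2) * (1 + ‖w‖ ^ 2)) - 1 := by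
  have h0 : 0 < (1 + ‖z‖ ^ 2) * (1 + ‖w‖ ^ 2) := by positivity
  have h1 : ‖1 + hermProd z w‖ / Real.sqrt ((1 + ‖z‖ ^ 2) * (1 + ‖w‖ ^ 2)) ≤ 1 := by
    rw [div_le_one (Real.sqrt_pos.2 h0)]
    exact Real.le_sqrt_of_sq_le (norm_one_add_hermProd_le z w)
  have h2 : -1 ≤ ‖1 + hermProd z w‖ / Real.sqrt ((1 + ‖z‖ ^ 2) * (1 + ‖w‖ ^ 2)) :=
    neg_one_lt_zero.le.trans (by positivity)
  rw [fubiniStudyDist, Real.cos_two_mul, Real.cos_arccos h2 h1, div_pow, Real.sq_sqrt h0.le]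
  ring

end

end

/-! ### Assembly -/

theorem mainTheorem1 (n m k : ℕ) (hn : 1 ≤ n) (ν : ℝ) (hν : 2 * ν = (k : ℝ))
    (h : ∀ p q : ℕ, Module.Basis (Fin (harmonicDim n p q)) ℂ (bihomHarmonic n p q))
    (hh : ∀ p q : ℕ, IsSphereOrthonormal (h p q))
    (z w : EuclideanSpace ℂ (Fin n)) :
    (∑ p ∈ Finset.range (m + 1), ∑ q ∈ Finset.range (m + k + 1),
        ∑ j : Fin (harmonicDim n p q),
          eigenPhi ν m p q (h p q j : MvPolynomial (Fin n ⊕ Fin n) ℂ) z *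
            conj (eigenPhi ν m p q (h p q j : MvPolynomial (Fin n ⊕ Fin n) ℂ) w)) =
      (((2 * m + 2 * ν + n) * Real.Gamma (m + 2 * ν + n) /
          (Real.pi ^ n * Real.Gamma (m + 2 * ν + 1)) : ℝ) : ℂ) *
        ((1 + hermProd w z) ^ k /
          ((((1 + ‖z‖ ^ 2) * (1 + ‖w‖ ^ 2)) ^ ν : ℝ) : ℂ)) *
        ((jacobiP m ((n : ℝ) - 1) (2 * ν) (Real.cos (2 * fubiniStudyDist z w)) : ℝ) : ℂ) ∧
    Real.cos (2 * fubiniStudyDist z w) =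
      2 * ‖1 + hermProd z w‖ ^ 2 / ((1 + ‖z‖ ^ 2) * (1 + ‖w‖ ^ 2)) - 1 := by
  refine ⟨?_, cos_two_mul_fubiniStudyDist z w⟩
  obtain ⟨n, rfl⟩ := Nat.exists_eq_add_of_le' hn
  set a := ‖z‖ ^ 2 with ha
  set b := ‖w‖ ^ 2 with hb
  have ha0 : 0 < 1 + a := by positivity
  have hb0 : 0 < 1 + b := by positivity
  have hab : 0 < (1 + a) * (1 + b) := by positivity
  set s := hermProd z w
  set t := hermProd w z
  set K : ℝ := (2 * m + 2 * ν + (n + 1 : ℕ)) * Real.Gamma (m + 2 * ν + (n + 1 : ℕ)) /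
    (Real.pi ^ (n + 1) * Real.Gamma (m + 2 * ν + 1)) with hK
  set ρ : ℝ := (1 + a) ^ (-(m : ℝ) - ν) * (1 + b) ^ (-(m : ℝ) - ν) with hρ
  have hterm : ∀ p ∈ Finset.range (m + 1), ∀ q ∈ Finset.range (m + k + 1),
      ∑ j, eigenPhi ν m p q (h p q j : MvPolynomial (Fin (n + 1) ⊕ Fin (n + 1)) ℂ) z *
        conj (eigenPhi ν m p q (h p q j : MvPolynomial (Fin (n + 1) ⊕ Fin (n + 1)) ℂ) w) =
      ((K * ρ : ℝ) : ℂ) * (((kernelBase (n + 1) m k p q * radialPoly (n + 1) m k p q a *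
        radialPoly (n + 1) m k p q b : ℝ) : ℂ) * zonalPoly (n + 1) p q s t (a * b)) := by
    intro p hp q hq
    have hp : p ≤ m := Nat.lt_succ_iff.1 (Finset.mem_range.1 hp)
    have hq : q ≤ m + k := Nat.lt_succ_iff.1 (Finset.mem_range.1 hq)
    have e1 := sum_orthonormal_basis_eq_zonalPoly hn (h p q) (hh p q) z w
    have e2 := normConst_sq_mul n m k p q ν hν hp hq
    rw [Nat.add_sub_cancel] at e1
    have e3 := ordinaryHypergeometric_neg_eq_radialPoly (n + 1) m k p q hp
    simp only [eigenPhi, map_mul, Complex.conj_ofReal, hν, e3, ← ha, ← hb]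
    set Z := zonalPoly (n + 1) p q s t (a * b)
    set N := normConst (n + 1) ν m p q
    set Fa := radialPoly (n + 1) m k p q a
    set Fb := radialPoly (n + 1) m k p q b
    calc _ = ((N ^ 2 * ρ * Fa * Fb : ℝ) : ℂ) *
          ∑ j, evalConj (h p q j : MvPolynomial (Fin (n + 1) ⊕ Fin (n + 1)) ℂ) z *
            conj (evalConj (h p q j : MvPolynomial (Fin (n + 1) ⊕ Fin (n + 1)) ℂ) w) := by
          rw [Finset.mul_sum]
          refine Finset.sum_congr rfl fun j _ => ?_
          rw [hρ]
          push_cast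
          ring
      _ = ((N ^ 2 * ((n + (p + q)).factorial /
            (2 * Real.pi ^ (n + 1) * (p.factorial * q.factorial))) * (ρ * Fa * Fb) : ℝ) : ℂ) *
            Z := by
          rw [e1]
          push_cast
          ring
      _ = _ := by
          rw [e2, ← hK]
          push_cast
          ring
  rw [Finset.sum_congr rfl fun p hp => Finset.sum_congr rfl fun q hq => hterm p hp q hq]
  simp only [← Finset.mul_sum]
  rw [sum_kernelBase_mul_zonalPoly (n + 1) m k hn a b s t]
  have hT : conj (1 + s) = 1 + t := by
    rw [map_add, map_one, MvPolynomial.conj_hermProd]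
  have hy : ((‖1 + s‖ ^ 2 : ℝ) : ℂ) = (1 + s) * (1 + t) := by
    rw [← hT, Complex.mul_conj']
    push_cast
    rfl
  have hcos : Real.cos (2 * fubiniStudyDist z w) =
      2 * (‖1 + s‖ ^ 2 / ((1 + a) * (1 + b))) - 1 := by
    rw [cos_two_mul_fubiniStudyDist, mul_div_assoc]
  have hρ' : ρ = (((1 + a) * (1 + b)) ^ m)⁻¹ * (((1 + a) * (1 + b)) ^ ν)⁻¹ := by
    rw [hρ, ← Real.mul_rpow ha0.le hb0.le, sub_eq_add_neg, Real.rpow_add hab, Real.rpow_neg hab.le,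
      Real.rpow_neg hab.le, Real.rpow_natCast]
  have hJ : jacobiP m (((n + 1 : ℕ) : ℝ) - 1) (2 * ν) (Real.cos (2 * fubiniStudyDist z w)) =
      ∑ l ∈ Finset.range (m + 1), jacobiCoeff (n + 1) m k l *
        (‖1 + s‖ ^ 2 / ((1 + a) * (1 + b))) ^ l := by
    rw [hcos, hν, show ((n + 1 : ℕ) : ℝ) - 1 = n by push_cast; ring, jacobiP_eq_sum]
  rw [hJ, hρ', Complex.ofReal_mul, mul_assoc, mul_assoc]
  congr 1
  clear_value a b
  have habC : ((1 : ℂ) + a) * (1 + b) ≠ 0 := by exact_mod_cast hab.ne'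
  -- Since t is conjugate to s, (1+s)(1+t) = |1+s|². Factoring out (1+t)^k ((1+a)(1+b))^m turns the
  -- kernel into the Jacobi polynomial at y = cos² d.
  have hsum : ∑ l ∈ Finset.range (m + 1), (jacobiCoeff (n + 1) m k l : ℂ) * (1 + s) ^ l *
      (1 + t) ^ (l + k) * ((1 + a) * (1 + b)) ^ (m - l) =
      (1 + t) ^ k * ((1 + a) * (1 + b)) ^ m * ((∑ l ∈ Finset.range (m + 1),
        jacobiCoeff (n + 1) m k l * (‖1 + s‖ ^ 2 / ((1 + a) * (1 + b))) ^ l : ℝ) : ℂ) := by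
    rw [Complex.ofReal_sum, Finset.mul_sum]
    refine Finset.sum_congr rfl fun l hl => ?_
    have hl : l ≤ m := Nat.lt_succ_iff.1 (Finset.mem_range.1 hl)
    rw [Complex.ofReal_mul, Complex.ofReal_pow, Complex.ofReal_div, hy, div_pow, mul_pow, pow_add]
    push_cast
    rw [← pow_sub_mul_pow _ hl]
    field_simp
    simp only [mul_pow]
    ring
  rw [hsum]
  have hνC : (((((1 + a) * (1 + b)) ^ ν : ℝ)) : ℂ) ≠ 0 := by
    exact_mod_cast (Real.rpow_pos_of_pos hab ν).ne'
  rw [Complex.ofReal_mul, Complex.ofReal_inv, Complex.ofReal_inv, Complex.ofReal_pow]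
  generalize ((((1 + a) * (1 + b)) ^ ν : ℝ) : ℂ) = Λ at *
  push_cast
  field_simp
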